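/- Let $n\ge 1$. Equip $\mathbb Q^{2n}\supset\mathbb Z^{2n}$ with the standard symplectic form $\omega$ (symplectic basis $\vec e_1,\vec f_1,\dots,\vec e_n,\vec f_n$, $\omega(\vec e_i,\vec f_i)=1$). Let $T^\omega_n$ be the poset of non-zero isotropic subspaces of $\mathbb Q^{2n}$ ordered by inclusion and $\mathrm{St}^\omega_n=\tilde H_{n-1}(T^\omega_n;\mathbb Z)$ the reduced homology of its order complex. All homology is simplicial with $\mathbb Z$-coefficients. *The complexes $\mathcal I_n^\delta\subset\mathcal{IA}_n$.* Their vertices are the rank-1 summands $v$ of $\mathbb Z^{2n}$; write $\vec v$ for a generator of $v$. A set $\{v_0,\dots,v_k\}$ of $k+1$ such lines is called - *standard* if $\langle \vec v_0,\dots,\vec v_k\rangle$ is an isotropic summand of $\mathbb Z^{2n}$ of rank $k+1$; - *2-additive* if (for a suitable labelling) $\vec v_0=\pm\vec v_1\pm\vec v_2$ and $\{v_1,\dots,v_k\}$ is standard; - a *$\sigma$ simplex* if $k \geq 1$ and (for a suitable labelling) $\omega(\vec v_k,\vec v_{k-1})=\pm1$, $\omega(\vec v_k,\vec v_i)=0$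 for $i\le k-2$, and $\{v_0,\dots,v_{k-1}\}$ is standard; the edge $\{v_{k-1},v_k\}$ is its $\sigma$ edge; - *mixed* if $k\ge 4$ and, for a suitable labelling, omitting $v_0$ gives a $\sigma$ simplex with $\sigma$ edge $\{v_{k-1},v_k\}$ and omitting $v_k$ gives a 2-additive simplex with $\vec v_0=\pm\vec v_1\pm\vec v_2$. The simplices of $\mathcal I_n^\delta$ are the standard and the 2-additive ones; those of $\mathcal{IA}_n$ are the standard, 2-additive, $\sigma$ and mixed ones. *The model disc.* Let $\partial\beta_n$ be the simplicial complex on the vertex set $\{1,\bar 1,\dots,n,\bar n\}$ whose simplices are the non-empty subsets containing no pair $\{a,\bar a\}$, and let $\beta_n\supset\partial\beta_n$ have as additional simplices the subsets that contain $\{n,\bar n\}$ and no other such pair. Fix a generator $\xi_0\in\tilde H_0(\partial\beta_1)\cong\mathbb Z$ and let $\xi=\xi_{n-1}\in\tilde H_{n-1}(\partial\beta_n)$ be obtained from it by the iterated suspension isomorphism ($\partial\beta_{n}=\partial\beta_{n-1}*\{n,\bar n\}$). The connecting morphism $H_n(\beta_n,\partial\beta_n)\to\tilde H_{n-1}(\partial\beta_n)$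 is an isomorphism; the fundamental class of $(\beta_n,\partial\beta_n)$ is the preimage of $\xi$. *The maps.* For a simplicial complex $X$ let $P(X)$ be its poset of simplices (identified with its order complex in homology) and $b:\tilde H_{*}(X)\to\tilde H_{*}(P(X))$ the map induced by barycentric subdivision of chains. For $M\in\mathrm{Sp}_{2n}(\mathbb Z)$ let $(\vec M_a)_{a\in\{1,\bar1,\dots,n,\bar n\}}$ be its columns, where $\vec M_i = M\vec e_i$ and $\vec M_{\bar i}=M\vec f_i$. - The integral apartment class map is the homomorphism $[-]:\mathbb Z[\mathrm{Sp}_{2n}(\mathbb Z)]\to\mathrm{St}^\omega_n$ with $[M]=\partial M_\star(b(\xi))$, where $\partial M:P(\partial\beta_n)\to T^\omega_n$, $I\mapsto\langle\vec M_a:a\in I\rangle_{\mathbb Q}$. - $\alpha:\mathbb Z[\mathrm{Sp}_{2n}(\mathbb Z)]\to H_n(\mathcal{IA}_n,\mathcal I_n^\delta)$ is the homomorphism that sends $M$ to the image of the fundamental class of $(\beta_n,\partial\beta_n)$ under the simplicial map of pairs $(\beta_n,\partial\beta_n)\to(\mathcal{IA}_n,\mathcal I_n^\delta)$, $a\mapsto\langle\vec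 M_a\rangle_{\mathbb Z}$. - $\delta:H_n(\mathcal{IA}_n,\mathcal I_n^\delta)\to\tilde H_{n-1}(\mathcal I_n^\delta)$ is the connecting morphism of the pair. - $s_\star:\tilde H_{n-1}(P(\mathcal I_n^\delta))\to\mathrm{St}^\omega_n$ is induced by the poset map $\Delta\mapsto\langle\Delta\rangle_{\mathbb Q}$. **Proposition.** The map $b:\tilde H_{n-1}(\mathcal I_n^\delta)\to\tilde H_{n-1}(P(\mathcal I_n^\delta))$ is an isomorphism, and the integral apartment class map factors as $$[-]=s_\star\circ b\circ\delta\circ\alpha .$$ -/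

import Mathlib

noncomputable section

namespace SymplecticApartments

/-! ### Simplicial homology

Simplicial complexes are Mathlib's `AbstractSimplicialComplex`. Homology is computed from ordered
chains: the generators are the tuples of vertices (repetitions allowed) whose entries span a
simplex. The complex is augmented and indexed by the number of entries of a tuple, so that index
`k` is degree `k - 1`. -/

/-- Integral linear combinations of `k`-tuples of vertices. -/
abbrev Chains (ι : Type*) (k : ℕ) : Type _ := (Fin k → ι) →₀ ℤ

/-- The simplicial boundary: it sends a tuple to the alternating sum of the tuples in which one
entry is omitted; in particular a one-entry tuple is sent to the empty tuple (augmentation). -/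
def bdry {ι : Type*} (k : ℕ) : Chains ι (k + 1) →ₗ[ℤ] Chains ι k :=
  Finsupp.linearCombination ℤ fun t : Fin (k + 1) → ι =>
    ∑ i : Fin (k + 1), Finsupp.single (fun j : Fin k => t (i.succAbove j)) ((-1 : ℤ) ^ (i : ℕ))

/-- Putting the vertex `a` in front of every tuple. -/
def cone {ι : Type*} (a : ι) (k : ℕ) : Chains ι k →ₗ[ℤ] Chains ι (k + 1) :=
  Finsupp.lmapDomain ℤ ℤ fun t => (Fin.cons a t : Fin (k + 1) → ι)

/-- The linear map on chains induced by a map of vertices. -/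
def push {ι κ : Type*} (f : ι → κ) (k : ℕ) : Chains ι k →ₗ[ℤ] Chains κ k :=
  Finsupp.lmapDomain ℤ ℤ fun t => f ∘ t

section
variable {ι κ : Type*}

theorem chains_hom_ext {M : Type*} [AddCommGroup M] {k : ℕ} {f g : Chains ι k →ₗ[ℤ] M}
    (h : ∀ t, f (Finsupp.single t 1) = g (Finsupp.single t 1)) : f = g :=
  Finsupp.lhom_ext' fun t => LinearMap.ext_ring (h t)

theorem bdry_single (k : ℕ) (t : Fin (k + 1) → ι) :
    bdry k (Finsupp.single t 1) =
      ∑ i : Fin (k + 1), Finsupp.single (fun j : Fin k => t (i.succAbove j))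
        ((-1 : ℤ) ^ (i : ℕ)) := by
  simp [bdry]

theorem cone_single (a : ι) (k : ℕ) (t : Fin k → ι) (m : ℤ) :
    cone a k (Finsupp.single t m) = Finsupp.single (Fin.cons a t : Fin (k + 1) → ι) m := by
  simp [cone, Finsupp.mapDomain_single]

theorem push_single (f : ι → κ) (k : ℕ) (t : Fin k → ι) (m : ℤ) :
    push f k (Finsupp.single t m) = Finsupp.single (f ∘ t) m := by
  simp [push, Finsupp.mapDomain_single]

theorem bdry_cone_zero (a : ι) (c : Chains ι 0) : bdry 0 (cone a 0 c) = c := by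
  have h : (bdry 0).comp (cone a 0) = (LinearMap.id : Chains ι 0 →ₗ[ℤ] Chains ι 0) := by
    apply chains_hom_ext
    intro t
    rw [LinearMap.comp_apply, LinearMap.id_apply, cone_single, bdry_single]
    rw [Fin.sum_univ_succ, Fin.sum_univ_zero, add_zero, Fin.val_zero, pow_zero]
    congr 1
  exact LinearMap.congr_fun h c

theorem bdry_cone_succ (a : ι) (k : ℕ) (c : Chains ι (k + 1)) :
    bdry (k + 1) (cone a (k + 1) c) = c - cone a k (bdry k c) := by
  have h : (bdry (k + 1)).comp (cone a (k + 1)) =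
      LinearMap.id - (cone a k).comp (bdry k) := by
    apply chains_hom_ext
    intro t
    rw [LinearMap.comp_apply, LinearMap.sub_apply, LinearMap.id_apply, LinearMap.comp_apply,
      cone_single, bdry_single, bdry_single,
      map_sum, Fin.sum_univ_succ, sub_eq_add_neg, ← Finset.sum_neg_distrib]
    congr 1
    refine Finset.sum_congr rfl fun i _ => ?_
    rw [cone_single, ← Finsupp.single_neg]
    congr 1
    · funext j
      refine Fin.cases ?_ (fun j => ?_) j <;> simp
    · simp [pow_succ]
  exact LinearMap.congr_fun h c

theorem bdry_bdry (k : ℕ) (c : Chains ι (k + 2)) : bdry k (bdry (k + 1) c) = 0 := by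
  induction k with
  | zero =>
    have h : (bdry 0).comp (bdry 1) = (0 : Chains ι 2 →ₗ[ℤ] Chains ι 0) := by
      apply chains_hom_ext
      intro t
      obtain ⟨a, s, rfl⟩ : ∃ a s, t = (Fin.cons a s : Fin 2 → ι) :=
        ⟨t 0, Fin.tail t, (Fin.cons_self_tail t).symm⟩
      rw [LinearMap.comp_apply, LinearMap.zero_apply, ← cone_single, bdry_cone_succ, map_sub,
        bdry_cone_zero, sub_self]
    exact LinearMap.congr_fun h c
  | succ k ih =>
    have h : (bdry (k + 1)).comp (bdry (k + 2)) =
        (0 : Chains ι (k + 3) →ₗ[ℤ] Chains ι (k + 1)) := by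
      apply chains_hom_ext
      intro t
      obtain ⟨a, s, rfl⟩ : ∃ a s, t = (Fin.cons a s : Fin (k + 3) → ι) :=
        ⟨t 0, Fin.tail t, (Fin.cons_self_tail t).symm⟩
      rw [LinearMap.comp_apply, LinearMap.zero_apply, ← cone_single, bdry_cone_succ, map_sub,
        bdry_cone_succ, ih, map_zero, sub_zero, sub_self]
    exact LinearMap.congr_fun h c

theorem bdry_push (f : ι → κ) (k : ℕ) (c : Chains ι (k + 1)) :
    bdry k (push f (k + 1) c) = push f k (bdry k c) := by
  have h : (bdry k).comp (push f (k + 1)) = (push f k).comp (bdry k) := by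
    apply chains_hom_ext
    intro t
    rw [LinearMap.comp_apply, LinearMap.comp_apply, push_single, bdry_single, bdry_single, map_sum]
    exact Finset.sum_congr rfl fun i _ => (push_single _ _ _ _).symm
  exact LinearMap.congr_fun h c

end

/-- A tuple spans a simplex if its entries are vertices of a common simplex; the empty tuple is
always allowed. -/
def Spans {ι : Type*} (X : AbstractSimplicialComplex ι) {k : ℕ} (t : Fin k → ι) : Prop :=
  k = 0 ∨ ∃ s ∈ X.faces, ∀ i, t i ∈ s

/-- The augmented ordered chains of the complex `X` in degree `k - 1`. -/
def chains {ι : Type*} (X : AbstractSimplicialComplex ι) (k : ℕ) : Submodule ℤ (Chains ι k) :=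
  Finsupp.supported ℤ ℤ {t | Spans X t}

/-- The reduced cycles of `X` in degree `k - 1`. -/
def cycles {ι : Type*} (X : AbstractSimplicialComplex ι) :
    (k : ℕ) → Submodule ℤ (Chains ι k)
  | 0 => chains X 0
  | k + 1 => chains X (k + 1) ⊓ LinearMap.ker (bdry k)

/-- The boundaries of `X` in degree `k - 1`. -/
def boundaries {ι : Type*} (X : AbstractSimplicialComplex ι) (k : ℕ) :
    Submodule ℤ (Chains ι k) :=
  (chains X (k + 1)).map (bdry k)

/-- The reduced simplicial homology group `H̃_{k-1}(X; ℤ)`, cycles modulo boundaries (note the shift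
of the index). -/
abbrev RedHomology {ι : Type*} (X : AbstractSimplicialComplex ι) (k : ℕ) : Type _ :=
  cycles X k ⧸ (boundaries X k).submoduleOf (cycles X k)

/-- The relative cycles of the pair `(X, A)` in degree `n`: chains of `X` whose boundary lies in
the subcomplex `A`. -/
def relCycles {ι : Type*} (X A : AbstractSimplicialComplex ι) (n : ℕ) :
    Submodule ℤ (Chains ι (n + 1)) :=
  chains X (n + 1) ⊓ (chains A n).comap (bdry n)

/-- The relative boundaries of the pair `(X, A)` in degree `n`. -/
def relBoundaries {ι : Type*} (X A : AbstractSimplicialComplex ι) (n : ℕ) :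
    Submodule ℤ (Chains ι (n + 1)) :=
  (chains X (n + 2)).map (bdry (n + 1)) ⊔ chains A (n + 1)

/-- The relative simplicial homology group `H_n(X, A; ℤ)` of a complex `X` and a subcomplex `A`
(no shift of the index). -/
abbrev RelHomology {ι : Type*} (X A : AbstractSimplicialComplex ι) (n : ℕ) : Type _ :=
  relCycles X A n ⧸ (relBoundaries X A n).submoduleOf (relCycles X A n)

section
variable {ι κ : Type*}

theorem single_mem_chains (X : AbstractSimplicialComplex ι) {k : ℕ} {t : Fin k → ι}
    (h : Spans X t) (m : ℤ) : Finsupp.single t m ∈ chains X k :=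
  Finsupp.single_mem_supported ℤ m h

theorem chains_le_iff (X : AbstractSimplicialComplex ι) {k : ℕ} {p : Submodule ℤ (Chains ι k)} :
    chains X k ≤ p ↔ ∀ t : Fin k → ι, Spans X t → Finsupp.single t (1 : ℤ) ∈ p := by
  rw [chains, Finsupp.supported_eq_span_single, Submodule.span_le]
  simp [Set.subset_def]

theorem chains_mono {X Y : AbstractSimplicialComplex ι} (h : X ≤ Y) (k : ℕ) :
    chains X k ≤ chains Y k :=
  Finsupp.supported_mono fun _ ht => ht.imp id fun ⟨s, hs, hst⟩ => ⟨s, h hs, hst⟩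

theorem bdry_mem_chains (X : AbstractSimplicialComplex ι) {k : ℕ} {c : Chains ι (k + 1)}
    (hc : c ∈ chains X (k + 1)) : bdry k c ∈ chains X k := by
  have : chains X (k + 1) ≤ (chains X k).comap (bdry k) := by
    rw [chains_le_iff]
    intro t ht
    rw [Submodule.mem_comap, bdry_single]
    refine Submodule.sum_mem _ fun i _ => single_mem_chains X ?_ _
    obtain h | ⟨s, hs, hst⟩ := ht
    · omega
    · exact Or.inr ⟨s, hs, fun j => hst _⟩
  exact this hc

theorem cycles_le_chains (X : AbstractSimplicialComplex ι) (k : ℕ) : cycles X k ≤ chains X k := by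
  cases k with
  | zero => exact le_rfl
  | succ k => exact inf_le_left

theorem bdry_mem_cycles (A : AbstractSimplicialComplex ι) {n : ℕ} {c : Chains ι (n + 1)}
    (hc : bdry n c ∈ chains A n) : bdry n c ∈ cycles A n := by
  cases n with
  | zero => exact hc
  | succ n => exact ⟨hc, bdry_bdry n c⟩

end

/-- The connecting morphism `H_n(X, A) → H̃_{n-1}(A)` of the long exact sequence of the pair: it
sends the class of a relative cycle to the class of its boundary. -/
def connecting {ι : Type*} (X A : AbstractSimplicialComplex ι) (n : ℕ) :
    RelHomology X A n →ₗ[ℤ] RedHomology A n :=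
  Submodule.mapQ _ _
    ((bdry n).restrict (p := relCycles X A n) (q := cycles A n)
      fun _ hc => bdry_mem_cycles A hc.2)
    (by
      rintro ⟨c, hc⟩ hc'
      obtain ⟨x, hx, a, ha, hxa⟩ := Submodule.mem_sup.1 (show c ∈ relBoundaries X A n from hc')
      obtain ⟨y, hy, rfl⟩ := hx
      refine ⟨a, ha, ?_⟩
      change bdry n a = bdry n c
      rw [← hxa, map_add, bdry_bdry, zero_add])

/-- A simplicial map: a map of vertices that sends simplices to simplices. -/
structure SimplicialMap {ι κ : Type*} (X : AbstractSimplicialComplex ι)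
    (Y : AbstractSimplicialComplex κ) where
  /-- the map of vertices -/
  toFun : ι → κ
  /-- the image of a simplex is a simplex -/
  image_mem : ∀ s ∈ X.faces, ∃ t ∈ Y.faces, (t : Set κ) = toFun '' s

section
variable {ι κ : Type*}

theorem push_mem_chains {X : AbstractSimplicialComplex ι} {Y : AbstractSimplicialComplex κ}
    (f : SimplicialMap X Y) {k : ℕ} {c : Chains ι k} (hc : c ∈ chains X k) :
    push f.toFun k c ∈ chains Y k := by
  have : chains X k ≤ (chains Y k).comap (push f.toFun k) := by
    rw [chains_le_iff]
    intro t ht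
    rw [Submodule.mem_comap, push_single]
    refine single_mem_chains Y ?_ _
    refine ht.imp id fun ⟨s, hs, hst⟩ => ?_
    obtain ⟨u, hu, hus⟩ := f.image_mem s hs
    refine ⟨u, hu, fun i => ?_⟩
    rw [← Finset.mem_coe, hus]
    exact ⟨t i, hst i, rfl⟩
  exact this hc

theorem push_mem_cycles {X : AbstractSimplicialComplex ι} {Y : AbstractSimplicialComplex κ}
    (f : SimplicialMap X Y) {k : ℕ} {c : Chains ι k} (hc : c ∈ cycles X k) :
    push f.toFun k c ∈ cycles Y k := by
  cases k with
  | zero => exact push_mem_chains f hc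
  | succ k =>
    refine ⟨push_mem_chains f hc.1, ?_⟩
    change bdry k _ = 0
    rw [bdry_push, LinearMap.mem_ker.1 hc.2, map_zero]

end

/-- The map induced by a simplicial map on reduced homology in degree `k - 1`. -/
def redMap {ι κ : Type*} {X : AbstractSimplicialComplex ι} {Y : AbstractSimplicialComplex κ}
    (f : SimplicialMap X Y) (k : ℕ) : RedHomology X k →ₗ[ℤ] RedHomology Y k :=
  Submodule.mapQ _ _
    ((push f.toFun k).restrict (p := cycles X k) (q := cycles Y k)
      fun _ hc => push_mem_cycles f hc)
    (by
      rintro ⟨c, hc⟩ ⟨x, hx, hxc⟩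
      refine ⟨push f.toFun (k + 1) x, push_mem_chains f hx, ?_⟩
      rw [bdry_push, hxc]
      rfl)

/-- The map induced on relative homology in degree `n` by a map of pairs, i.e. a simplicial map
`f : X → Y` that restricts to a simplicial map `g : A → B` of the subcomplexes. -/
def relMap {ι κ : Type*} {X A : AbstractSimplicialComplex ι} {Y B : AbstractSimplicialComplex κ}
    (f : SimplicialMap X Y) (g : SimplicialMap A B) (hfg : g.toFun = f.toFun) (n : ℕ) :
    RelHomology X A n →ₗ[ℤ] RelHomology Y B n :=
  Submodule.mapQ _ _
    ((push f.toFun (n + 1)).restrict (p := relCycles X A n) (q := relCycles Y B n)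
      fun c hc => ⟨push_mem_chains f hc.1, by
        have := push_mem_chains g hc.2
        rwa [hfg, ← bdry_push] at this⟩)
    (by
      rintro ⟨c, hc⟩ hc'
      obtain ⟨x, hx, a, ha, hxa⟩ := Submodule.mem_sup.1 (show c ∈ relBoundaries X A n from hc')
      obtain ⟨y, hy, rfl⟩ := hx
      change push f.toFun (n + 1) c ∈ relBoundaries Y B n
      rw [← hxa, map_add, ← bdry_push]
      refine Submodule.add_mem_sup ⟨_, push_mem_chains f hy, rfl⟩ ?_
      have := push_mem_chains g ha
      rwa [hfg] at this)

/-! ### Order complexes, posets of simplices and barycentric subdivision -/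

/-- The order complex of a poset: its simplices are the nonempty finite chains. -/
def orderComplex (P : Type*) [PartialOrder P] : AbstractSimplicialComplex P where
  faces := {s | s.Nonempty ∧ IsChain (· ≤ ·) (s : Set P)}
  isRelLowerSet_faces := fun _ hs =>
    ⟨hs.1, fun _ hts ht => ⟨ht, hs.2.mono (Finset.coe_subset.2 hts)⟩⟩
  singleton_mem := fun v => ⟨Finset.singleton_nonempty v, by simp⟩

/-- The simplicial map of order complexes induced by a poset map. -/
def orderComplexMap {P Q : Type*} [PartialOrder P] [PartialOrder Q] (f : P →o Q) :
    SimplicialMap (orderComplex P) (orderComplex Q) where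
  toFun := f
  image_mem := fun s hs => by
    classical
    refine ⟨s.image f, ⟨hs.1.image f, ?_⟩, Finset.coe_image⟩
    rw [Finset.coe_image]
    rintro _ ⟨a, ha, rfl⟩ _ ⟨b, hb, rfl⟩ _
    exact (hs.2.total ha hb).imp (fun h => f.monotone h) fun h => f.monotone h

/-- The poset of simplices `P(X)`, ordered by inclusion. -/
abbrev FacePoset {ι : Type*} (X : AbstractSimplicialComplex ι) : Type _ :=
  {s : Finset ι // s ∈ X.faces}

open Classical in
/-- The simplex spanned by a nonempty tuple whose entries are vertices of a common simplex. -/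
def spanSimplex {ι : Type*} (X : AbstractSimplicialComplex ι) {k : ℕ} (t : Fin (k + 1) → ι)
    (ht : Spans X t) : FacePoset X :=
  ⟨Finset.univ.image t, by
    obtain h | ⟨s, hs, hst⟩ := ht
    · omega
    · refine (X.isRelLowerSet_faces hs).2 ?_ ⟨t 0, Finset.mem_image_of_mem t (Finset.mem_univ 0)⟩
      intro x hx
      obtain ⟨i, _, rfl⟩ := Finset.mem_image.1 hx
      exact hst i⟩

open Classical in
/-- Barycentric subdivision on chains, `b : C_*(X) → C_*(P(X))`, by the usual recursion: a simplex
is sent to the cone, from its barycenter, over the subdivision of its boundary. (Tuples that do not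
span a simplex of `X` are sent to `0`.) -/
def subdivide {ι : Type*} (X : AbstractSimplicialComplex ι) :
    (k : ℕ) → Chains ι k →ₗ[ℤ] Chains (FacePoset X) k
  | 0 => Finsupp.lmapDomain ℤ ℤ fun _ => Fin.elim0
  | k + 1 => Finsupp.linearCombination ℤ fun t : Fin (k + 1) → ι =>
      if ht : Spans X t then
        cone (spanSimplex X t ht) k (subdivide X k (bdry k (Finsupp.single t 1)))
      else 0

section
variable {ι κ : Type*}

theorem subdivide_single (X : AbstractSimplicialComplex ι) {k : ℕ} {t : Fin (k + 1) → ι}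
    (ht : Spans X t) : subdivide X (k + 1) (Finsupp.single t 1) =
      cone (spanSimplex X t ht) k (subdivide X k (bdry k (Finsupp.single t 1))) := by
  rw [subdivide, Finsupp.linearCombination_single, one_smul, dif_pos ht]

theorem spans_omit (X : AbstractSimplicialComplex ι) {k : ℕ} {t : Fin (k + 1) → ι}
    (ht : Spans X t) (i : Fin (k + 1)) : Spans X fun j : Fin k => t (i.succAbove j) := by
  obtain h | ⟨s, hs, hst⟩ := ht
  · omega
  · exact Or.inr ⟨s, hs, fun j => hst _⟩

theorem bdry_subdivide (X : AbstractSimplicialComplex ι) (k : ℕ) {c : Chains ι (k + 1)}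
    (hc : c ∈ chains X (k + 1)) :
    bdry k (subdivide X (k + 1) c) = subdivide X k (bdry k c) := by
  induction k with
  | zero =>
    have : chains X 1 ≤ LinearMap.eqLocus ((bdry 0).comp (subdivide X 1))
        ((subdivide X 0).comp (bdry 0)) := by
      rw [chains_le_iff]
      intro t ht
      rw [LinearMap.mem_eqLocus, LinearMap.comp_apply, LinearMap.comp_apply,
        subdivide_single X ht, bdry_cone_zero]
    exact this hc
  | succ k ih =>
    have : chains X (k + 2) ≤ LinearMap.eqLocus ((bdry (k + 1)).comp (subdivide X (k + 2)))
        ((subdivide X (k + 1)).comp (bdry (k + 1))) := by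
      rw [chains_le_iff]
      intro t ht
      rw [LinearMap.mem_eqLocus, LinearMap.comp_apply, LinearMap.comp_apply,
        subdivide_single X ht, bdry_cone_succ,
        ih (bdry_mem_chains X (single_mem_chains X ht 1)), bdry_bdry, map_zero, map_zero,
        sub_zero]
    exact this hc

/-- The subdivision of a tuple consists of flags of faces of the simplex that it spans. -/
theorem subdivide_mem_supported (X : AbstractSimplicialComplex ι) : ∀ (k : ℕ) (t : Fin k → ι),
    Spans X t → subdivide X k (Finsupp.single t 1) ∈ Finsupp.supported ℤ ℤ
      {u : Fin k → FacePoset X | IsChain (· ≤ ·) (Set.range u) ∧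
        ∀ i, ((u i : Finset ι) : Set ι) ⊆ Set.range t} := by
  classical
  intro k
  induction k with
  | zero =>
    intro t _
    rw [subdivide, Finsupp.lmapDomain_apply, Finsupp.mapDomain_single]
    refine Finsupp.single_mem_supported ℤ _ ⟨?_, fun i => i.elim0⟩
    rw [Set.range_eq_empty]
    exact IsChain.empty
  | succ k ih =>
    intro t ht
    rw [subdivide_single X ht, bdry_single, map_sum, map_sum]
    refine Submodule.sum_mem _ fun i _ => ?_
    have h := ih _ (spans_omit X ht i)
    have h1 : Finsupp.single (fun j : Fin k => t (i.succAbove j)) ((-1 : ℤ) ^ (i : ℕ)) =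
        ((-1 : ℤ) ^ (i : ℕ)) • Finsupp.single (fun j : Fin k => t (i.succAbove j)) (1 : ℤ) := by
      simp
    rw [h1, map_smul, map_smul]
    refine Submodule.smul_mem _ _ ?_
    rw [Finsupp.supported_eq_span_single] at h
    refine Submodule.span_induction ?_ ?_ ?_ ?_ h
    · rintro _ ⟨u, ⟨hu, hut⟩, rfl⟩
      rw [cone_single]
      have key : ∀ j, ((u j : Finset ι) : Set ι) ⊆ Set.range t := fun j =>
        (hut j).trans (by rintro _ ⟨l, rfl⟩; exact ⟨_, rfl⟩)
      refine Finsupp.single_mem_supported ℤ _ ⟨?_, fun j => ?_⟩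
      · rw [Fin.range_cons]
        refine hu.insert ?_
        rintro _ ⟨j, rfl⟩ _
        refine Or.inr fun x hx => ?_
        obtain ⟨l, rfl⟩ := key j hx
        simp [spanSimplex]
      · refine Fin.cases ?_ (fun j => ?_) j
        · rw [Fin.cons_zero]
          intro x hx
          simpa [spanSimplex] using hx
        · rw [Fin.cons_succ]
          exact key j
    · rw [map_zero]; exact Submodule.zero_mem _
    · intro x y _ _ hx hy; rw [map_add]; exact Submodule.add_mem _ hx hy
    · intro a x _ hx; rw [map_smul]; exact Submodule.smul_mem _ _ hx

theorem subdivide_mem_chains (X : AbstractSimplicialComplex ι) {k : ℕ} {c : Chains ι k}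
    (hc : c ∈ chains X k) : subdivide X k c ∈ chains (orderComplex (FacePoset X)) k := by
  classical
  have : chains X k ≤ (chains (orderComplex (FacePoset X)) k).comap (subdivide X k) := by
    rw [chains_le_iff]
    intro t ht
    refine Finsupp.supported_mono ?_ (subdivide_mem_supported X k t ht)
    rintro u ⟨hu, _⟩
    cases k with
    | zero => exact Or.inl rfl
    | succ k =>
      refine Or.inr ⟨Finset.univ.image u, ⟨⟨u 0, Finset.mem_image_of_mem u (Finset.mem_univ 0)⟩,
        ?_⟩, fun i => Finset.mem_image_of_mem u (Finset.mem_univ i)⟩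
      rw [Finset.coe_image, Finset.coe_univ, Set.image_univ]
      exact hu
  exact this hc

end

/-- The map `b : H̃_{k-1}(X) → H̃_{k-1}(P(X))` induced by barycentric subdivision. -/
def subdivision {ι : Type*} (X : AbstractSimplicialComplex ι) (k : ℕ) :
    RedHomology X k →ₗ[ℤ] RedHomology (orderComplex (FacePoset X)) k :=
  Submodule.mapQ _ _
    ((subdivide X k).restrict (p := cycles X k) (q := cycles (orderComplex (FacePoset X)) k)
      fun c hc => by
        cases k with
        | zero => exact subdivide_mem_chains X hc
        | succ k =>
          refine ⟨subdivide_mem_chains X hc.1, ?_⟩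
          change bdry k _ = 0
          rw [bdry_subdivide X k hc.1, LinearMap.mem_ker.1 hc.2, map_zero])
    (by
      rintro ⟨c, hc⟩ ⟨x, hx, hxc⟩
      refine ⟨subdivide X (k + 1) x, subdivide_mem_chains X hx, ?_⟩
      rw [bdry_subdivide X k hx, hxc]
      rfl)

/-! ### Symplectic linear algebra -/

/-- The index set `{1, 1̄, …, n, n̄}` of the standard symplectic basis: `Sum.inl i` is the index of
`e_i` (written `i`) and `Sum.inr i` is the index of `f_i` (written `ī`). -/
abbrev SymIdx (n : ℕ) : Type := Fin n ⊕ Fin n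

/-- The standard symplectic form on `R^{2n}`, with `ω(e_i, f_i) = 1 = -ω(f_i, e_i)`. -/
def omega {n : ℕ} {R : Type*} [CommRing R] (x y : SymIdx n → R) : R :=
  ∑ i : Fin n, (x (Sum.inl i) * y (Sum.inr i) - x (Sum.inr i) * y (Sum.inl i))

/-- A submodule of `R^{2n}` is isotropic if the symplectic form vanishes on it. -/
def IsIsotropic {n : ℕ} {R : Type*} [CommRing R] (p : Submodule R (SymIdx n → R)) : Prop :=
  ∀ x ∈ p, ∀ y ∈ p, omega x y = 0

/-- The set of rank-1 summands of `ℤ^{2n}`. -/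
abbrev Line (n : ℕ) : Type :=
  {v : Submodule ℤ (SymIdx n → ℤ) // IsComplemented v ∧ Module.finrank ℤ v = 1}

instance (n : ℕ) : DecidableEq (Line n) := Classical.decEq _

/-- The submodule `⟨Δ⟩` of `ℤ^{2n}` spanned by a finite set of lines. -/
def lineSpan {n : ℕ} (s : Finset (Line n)) : Submodule ℤ (SymIdx n → ℤ) := ⨆ v ∈ s, v.1

/-- `x` is one of the two primitive vectors that generate the line `v`. -/
def Generates {n : ℕ} (x : SymIdx n → ℤ) (v : Line n) : Prop := v.1 = Submodule.span ℤ {x}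

/-- Standard simplices: the lines span an isotropic summand of rank the number of lines. -/
def IsStandard {n : ℕ} (s : Finset (Line n)) : Prop :=
  s.Nonempty ∧ IsIsotropic (lineSpan s) ∧ IsComplemented (lineSpan s) ∧
    Module.finrank ℤ (lineSpan s) = s.card

/-- `s` is a 2-additive simplex with `v₀ = ± v₁ ± v₂`. (The signs are absorbed in the choice of the
generators `x₁` and `x₂`.) -/
def IsTwoAdditiveWith {n : ℕ} (s : Finset (Line n)) (v₀ v₁ v₂ : Line n) : Prop :=
  v₀ ∈ s ∧ v₁ ∈ s.erase v₀ ∧ v₂ ∈ (s.erase v₀).erase v₁ ∧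
    (∃ x₁ x₂, Generates x₁ v₁ ∧ Generates x₂ v₂ ∧ Generates (x₁ + x₂) v₀) ∧
    IsStandard (s.erase v₀)

/-- 2-additive simplices. -/
def IsTwoAdditive {n : ℕ} (s : Finset (Line n)) : Prop :=
  ∃ v₀ v₁ v₂, IsTwoAdditiveWith s v₀ v₁ v₂

/-- `s` is a `σ` simplex with `σ` edge `{v, w}`: `ω(v, w) = ± 1`, the line `v` is orthogonal to all
lines other than `w`, and `s ∖ {v}` is a standard simplex. -/
def IsSigmaWith {n : ℕ} (s : Finset (Line n)) (v w : Line n) : Prop :=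
  v ∈ s ∧ w ∈ s.erase v ∧
    (∃ x y, Generates x v ∧ Generates y w ∧ (omega x y = 1 ∨ omega x y = -1)) ∧
    (∀ u ∈ (s.erase v).erase w, ∀ x ∈ v.1, ∀ y ∈ u.1, omega x y = 0) ∧
    IsStandard (s.erase v)

/-- `σ` simplices. -/
def IsSigma {n : ℕ} (s : Finset (Line n)) : Prop := ∃ v w, IsSigmaWith s v w

/-- Mixed simplices: `s ∖ {v₀}` is a `σ` simplex with `σ` edge `{v, w}`, `s ∖ {v}` is a 2-additive
simplex with `v₀ = ± v₁ ± v₂`, and the `σ` edge is disjoint from `{v₀, v₁, v₂}`. -/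
def IsMixed {n : ℕ} (s : Finset (Line n)) : Prop :=
  ∃ v₀ v₁ v₂ v w, v₀ ∈ s ∧ v ∈ s ∧ w ≠ v₁ ∧ w ≠ v₂ ∧
    IsSigmaWith (s.erase v₀) v w ∧ IsTwoAdditiveWith (s.erase v) v₀ v₁ v₂

section
variable {n : ℕ} {R : Type*} [CommRing R]

theorem omega_add_left (x y z : SymIdx n → R) : omega (x + y) z = omega x z + omega y z := by
  simp only [omega, ← Finset.sum_add_distrib, Pi.add_apply]
  exact Finset.sum_congr rfl fun _ _ => by ring

theorem omega_smul_left (a : R) (x y : SymIdx n → R) : omega (a • x) y = a * omega x y := by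
  simp only [omega, Finset.mul_sum, Pi.smul_apply, smul_eq_mul]
  exact Finset.sum_congr rfl fun _ _ => by ring

theorem omega_swap (x y : SymIdx n → R) : omega y x = -omega x y := by
  simp only [omega, ← Finset.sum_neg_distrib]
  exact Finset.sum_congr rfl fun _ _ => by ring

theorem omega_self (x : SymIdx n → R) : omega x x = 0 := by
  simp only [omega]
  exact Finset.sum_eq_zero fun _ _ => by ring

theorem omega_add_right (x y z : SymIdx n → R) : omega x (y + z) = omega x y + omega x z := by
  rw [omega_swap, omega_add_left, omega_swap x y, omega_swap x z]; ring

theorem omega_smul_right (a : R) (x y : SymIdx n → R) : omega x (a • y) = a * omega x y := by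
  rw [omega_swap, omega_smul_left, omega_swap x y]; ring

theorem omega_zero_left (y : SymIdx n → R) : omega 0 y = 0 := by simp [omega]

theorem omega_zero_right (x : SymIdx n → R) : omega x 0 = 0 := by simp [omega]

/-- The linear functional `ω(·, y)`. -/
def omegaLeft (y : SymIdx n → R) : (SymIdx n → R) →ₗ[R] R where
  toFun x := omega x y
  map_add' a b := omega_add_left a b y
  map_smul' a b := omega_smul_left a b y

theorem isIsotropic_span {S : Set (SymIdx n → R)} (h : ∀ x ∈ S, ∀ y ∈ S, omega x y = 0) :
    IsIsotropic (Submodule.span R S) := by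
  intro x hx y hy
  induction hx using Submodule.span_induction with
  | zero => exact omega_zero_left y
  | add a b _ _ ha hb => rw [omega_add_left, ha, hb, add_zero]
  | smul a b _ hb => rw [omega_smul_left, hb, mul_zero]
  | mem x hx =>
    induction hy using Submodule.span_induction with
    | zero => exact omega_zero_right x
    | add a b _ _ ha hb => rw [omega_add_right, ha, hb, add_zero]
    | smul a b _ hb => rw [omega_smul_right, hb, mul_zero]
    | mem y hy => exact h x hx y hy

theorem exists_generates (v : Line n) : ∃ x, Generates x v := by
  obtain ⟨x, hx⟩ := finrank_eq_one_iff'.1 v.2.2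
  refine ⟨x.1, le_antisymm (fun y hy => ?_) ?_⟩
  · obtain ⟨c, hc⟩ := hx.2 ⟨y, hy⟩
    rw [Submodule.mem_span_singleton]
    exact ⟨c, congrArg Subtype.val hc⟩
  · rw [Submodule.span_singleton_le_iff_mem]
    exact x.2

/-- A chosen generator of a line. -/
def gen (v : Line n) : SymIdx n → ℤ := (exists_generates v).choose

theorem generates_gen (v : Line n) : Generates (gen v) v := (exists_generates v).choose_spec

theorem lineSpan_eq_span {s : Finset (Line n)} {g : Line n → SymIdx n → ℤ}
    (hg : ∀ v ∈ s, Generates (g v) v) : lineSpan s = Submodule.span ℤ (g '' s) := by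
  rw [lineSpan, Set.image_eq_iUnion, Submodule.span_iUnion₂]
  exact iSup_congr fun v => iSup_congr fun hv => hg v hv

theorem lineSpan_mono {s t : Finset (Line n)} (h : s ⊆ t) : lineSpan s ≤ lineSpan t :=
  biSup_mono fun _ hv => h hv

theorem le_lineSpan {s : Finset (Line n)} {v : Line n} (h : v ∈ s) : v.1 ≤ lineSpan s :=
  le_biSup (fun v : Line n => v.1) h

theorem Generates.mem {x : SymIdx n → ℤ} {v : Line n} (h : Generates x v) : x ∈ v.1 := by
  rw [h]; exact Submodule.mem_span_singleton_self x

theorem lineSpan_le {s : Finset (Line n)} {p : Submodule ℤ (SymIdx n → ℤ)} :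
    lineSpan s ≤ p ↔ ∀ v ∈ s, v.1 ≤ p := iSup₂_le_iff

/-- Vectors with a system of dual functionals span a summand of the right rank. -/
theorem summand_of_dual {ι : Type*} {s : Finset ι} {g : ι → SymIdx n → ℤ}
    {φ : ι → (SymIdx n → ℤ) →ₗ[ℤ] ℤ} (h1 : ∀ v ∈ s, φ v (g v) = 1)
    (h0 : ∀ v ∈ s, ∀ w ∈ s, v ≠ w → φ v (g w) = 0) :
    IsComplemented (Submodule.span ℤ (g '' s)) ∧
      Module.finrank ℤ (Submodule.span ℤ (g '' s)) = s.card := by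
  classical
  have hdual : ∀ c : ι → ℤ, ∀ v ∈ s, φ v (∑ w ∈ s, c w • g w) = c v := by
    intro c v hv
    rw [map_sum, Finset.sum_eq_single v]
    · rw [map_smul, h1 v hv, smul_eq_mul, mul_one]
    · intro w hw hwv
      rw [map_smul, h0 v hv w hw hwv.symm, smul_zero]
    · exact fun h => (h hv).elim
  constructor
  · let f : (SymIdx n → ℤ) →ₗ[ℤ] Submodule.span ℤ (g '' s) :=
      LinearMap.codRestrict _ (∑ v ∈ s, (φ v).smulRight (g v)) fun x => by
        rw [LinearMap.sum_apply]
        exact Submodule.sum_mem _ fun v hv =>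
          Submodule.smul_mem _ _ (Submodule.subset_span ⟨v, hv, rfl⟩)
    have hf : ∀ x : Submodule.span ℤ (g '' s), f x = x := by
      rintro ⟨x, hx⟩
      apply Subtype.ext
      change (∑ v ∈ s, (φ v).smulRight (g v)) x = x
      rw [LinearMap.sum_apply]
      induction hx using Submodule.span_induction with
      | zero => simp
      | add a b _ _ ha hb =>
        simp only [map_add, Finset.sum_add_distrib]
        rw [ha, hb]
      | smul a b _ hb =>
        simp only [map_smul]
        rw [← Finset.smul_sum, hb]
      | mem x hx =>
        obtain ⟨w, hw, rfl⟩ := hx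
        rw [Finset.sum_eq_single w]
        · simp [h1 w hw]
        · intro v hv hvw
          simp [h0 v hv w hw hvw]
        · exact fun h => (h hw).elim
    exact ⟨_, LinearMap.isCompl_of_proj hf⟩
  · have hli : LinearIndependent ℤ fun v : s => g v := by
      rw [Fintype.linearIndependent_iff]
      intro c hc v
      have := hdual (fun w => if hw : w ∈ s then c ⟨w, hw⟩ else 0) v.1 v.2
      rw [← Finset.sum_coe_sort s] at this
      simp only [Finset.coe_mem, dite_true, Subtype.coe_eta] at this
      rw [← this, hc, map_zero]
    have := finrank_span_eq_card hli
    rw [Fintype.card_coe] at this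
    rw [← this, Set.image_eq_range]
    rfl

/-- The converse of `summand_of_dual`. -/
theorem exists_dual {s : Finset (Line n)} (h : IsComplemented (lineSpan s))
    (hr : Module.finrank ℤ (lineSpan s) = s.card) :
    ∃ φ : Line n → (SymIdx n → ℤ) →ₗ[ℤ] ℤ, (∀ v ∈ s, φ v (gen v) = 1) ∧
      ∀ v ∈ s, ∀ w ∈ s, v ≠ w → φ v (gen w) = 0 := by
  classical
  obtain ⟨q, hq⟩ := h
  let g : s → lineSpan s := fun v => ⟨gen v.1, le_lineSpan v.2 (generates_gen v.1).mem⟩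
  have htop : ⊤ ≤ Submodule.span ℤ (Set.range g) := by
    rintro ⟨x, hx⟩ -
    have hx' := hx
    rw [lineSpan_eq_span fun v _ => generates_gen v] at hx'
    have : (Submodule.span ℤ (Set.range g)).map (lineSpan s).subtype =
        Submodule.span ℤ (gen '' s) := by
      rw [Submodule.map_span, ← Set.range_comp]
      congr 1
      ext y
      simp [g]
    rw [← this] at hx'
    obtain ⟨y, hy, hyx⟩ := hx'
    have : y = ⟨x, hx⟩ := Subtype.ext hyx
    rwa [← this]
  have hli : LinearIndependent ℤ g :=
    linearIndependent_of_top_le_span_of_card_eq_finrank htop (by rw [hr, Fintype.card_coe])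
  let b := Module.Basis.mk hli htop
  let pr : (SymIdx n → ℤ) →ₗ[ℤ] lineSpan s := Submodule.projectionOnto _ _ hq
  refine ⟨fun v => if hv : v ∈ s then (b.coord ⟨v, hv⟩).comp pr else 0, ?_, ?_⟩
  · intro v hv
    have : pr (gen v) = b ⟨v, hv⟩ := by
      rw [Module.Basis.mk_apply]
      exact Submodule.projectionOnto_apply_left hq (g ⟨v, hv⟩)
    simp only [hv, dite_true, LinearMap.comp_apply, this]
    simp
  · intro v hv w hw hvw
    have : pr (gen w) = b ⟨w, hw⟩ := by
      rw [Module.Basis.mk_apply]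
      exact Submodule.projectionOnto_apply_left hq (g ⟨w, hw⟩)
    simp only [hv, dite_true, LinearMap.comp_apply, this]
    simp [hvw.symm]

/-- A criterion for standard simplices. -/
theorem isStandard_of_dual {s : Finset (Line n)} {g : Line n → SymIdx n → ℤ} (hs : s.Nonempty)
    (hg : ∀ v ∈ s, Generates (g v) v) (hω : ∀ v ∈ s, ∀ w ∈ s, omega (g v) (g w) = 0)
    {φ : Line n → (SymIdx n → ℤ) →ₗ[ℤ] ℤ} (h1 : ∀ v ∈ s, φ v (g v) = 1)
    (h0 : ∀ v ∈ s, ∀ w ∈ s, v ≠ w → φ v (g w) = 0) : IsStandard s := by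
  rw [IsStandard, lineSpan_eq_span hg]
  refine ⟨hs, isIsotropic_span ?_, summand_of_dual h1 h0⟩
  rintro _ ⟨v, hv, rfl⟩ _ ⟨w, hw, rfl⟩
  exact hω v hv w hw

theorem IsStandard.omega_eq_zero {s : Finset (Line n)} (hs : IsStandard s) {v w : Line n}
    (hv : v ∈ s) (hw : w ∈ s) {x y : SymIdx n → ℤ} (hx : x ∈ v.1) (hy : y ∈ w.1) :
    omega x y = 0 :=
  hs.2.1 x (le_lineSpan hv hx) y (le_lineSpan hw hy)

theorem IsStandard.subset {s t : Finset (Line n)} (hs : IsStandard s) (hts : t ⊆ s)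
    (ht : t.Nonempty) : IsStandard t := by
  obtain ⟨φ, h1, h0⟩ := exists_dual hs.2.2.1 hs.2.2.2
  exact isStandard_of_dual ht (fun v _ => generates_gen v)
    (fun v hv w hw => hs.omega_eq_zero (hts hv) (hts hw) (generates_gen v).mem
      (generates_gen w).mem)
    (fun v hv => h1 v (hts hv)) fun v hv w hw => h0 v (hts hv) w (hts hw)

theorem isStandard_singleton (v : Line n) : IsStandard {v} := by
  have h : lineSpan {v} = v.1 := by simp [lineSpan]
  rw [IsStandard, h]
  refine ⟨Finset.singleton_nonempty v, ?_, v.2.1, by simpa using v.2.2⟩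
  have := generates_gen v
  rw [this]
  refine isIsotropic_span ?_
  rintro _ rfl _ rfl
  exact omega_self _

/-- In a 2-additive simplex the roles of the three dependent lines can be exchanged. -/
theorem IsTwoAdditiveWith.isStandard_erase {s : Finset (Line n)} {v₀ v₁ v₂ : Line n}
    (h : IsTwoAdditiveWith s v₀ v₁ v₂) : IsStandard (s.erase v₁) ∧ IsStandard (s.erase v₂) ∧
      lineSpan s = lineSpan (s.erase v₀) := by
  obtain ⟨hv₀, hv₁, hv₂, ⟨x₁, x₂, hx₁, hx₂, hx₀⟩, hs⟩ := h
  rw [Finset.mem_erase] at hv₁ hv₂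
  have hv₂' := Finset.mem_erase.1 hv₂.2
  have key : ∀ a b c : Line n, ∀ x y z : SymIdx n → ℤ, Generates x a → Generates y b →
      Generates z c → b ∈ s → c ∈ s → b ≠ a → c ≠ a →
      x ∈ Submodule.span ℤ {y, z} → lineSpan s = lineSpan (s.erase a) := by
    intro a b c x y z hx hy hz hb hc hba hca hxyz
    refine le_antisymm (lineSpan_le.2 fun v hv => ?_) (lineSpan_mono (Finset.erase_subset a s))
    by_cases hva : v = a
    · subst hva
      rw [hx, Submodule.span_singleton_le_iff_mem]
      refine Submodule.span_le.2 ?_ hxyz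
      rintro u (rfl | rfl)
      · exact le_lineSpan (Finset.mem_erase.2 ⟨hba, hb⟩) hy.mem
      · exact le_lineSpan (Finset.mem_erase.2 ⟨hca, hc⟩) hz.mem
    · exact le_lineSpan (Finset.mem_erase.2 ⟨hva, hv⟩)
  have e₀ := key v₀ v₁ v₂ _ _ _ hx₀ hx₁ hx₂ hv₁.2 hv₂'.2 hv₁.1 hv₂'.1
    (Submodule.mem_span_pair.2 ⟨1, 1, by simp⟩)
  have e₁ := key v₁ v₀ v₂ _ _ _ hx₁ hx₀ hx₂ hv₀ hv₂'.2 hv₁.1.symm hv₂.1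
    (Submodule.mem_span_pair.2 ⟨1, -1, by simp⟩)
  have e₂ := key v₂ v₀ v₁ _ _ _ hx₂ hx₀ hx₁ hv₀ hv₁.2 hv₂'.1.symm hv₂.1.symm
    (Submodule.mem_span_pair.2 ⟨1, -1, by simp⟩)
  have main : ∀ a ∈ s, a ≠ v₀ → lineSpan s = lineSpan (s.erase a) → IsStandard (s.erase a) := by
    intro a ha hav e
    rw [IsStandard, ← e, e₀, Finset.card_erase_of_mem ha, ← Finset.card_erase_of_mem hv₀]
    exact ⟨⟨v₀, Finset.mem_erase.2 ⟨hav.symm, hv₀⟩⟩, hs.2⟩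
  exact ⟨main v₁ hv₁.2 hv₁.1 e₁, main v₂ hv₂'.2 hv₂'.1 e₂, e₀⟩

theorem IsTwoAdditiveWith.subset {s t : Finset (Line n)} {v₀ v₁ v₂ : Line n}
    (h : IsTwoAdditiveWith s v₀ v₁ v₂) (hts : t ⊆ s) (h₀ : v₀ ∈ t) (h₁ : v₁ ∈ t) (h₂ : v₂ ∈ t) :
    IsTwoAdditiveWith t v₀ v₁ v₂ := by
  obtain ⟨hv₀, hv₁, hv₂, hx, hs⟩ := h
  have h1 : v₁ ∈ t.erase v₀ := Finset.mem_erase.2 ⟨(Finset.mem_erase.1 hv₁).1, h₁⟩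
  refine ⟨h₀, h1, ?_, hx, hs.subset (Finset.erase_subset_erase _ hts) ⟨_, h1⟩⟩
  simp only [Finset.mem_erase] at hv₂ ⊢
  exact ⟨hv₂.1, hv₂.2.1, h₂⟩

theorem IsTwoAdditive.subset {s t : Finset (Line n)} (h : IsTwoAdditive s) (hts : t ⊆ s)
    (ht : t.Nonempty) : IsStandard t ∨ IsTwoAdditive t := by
  obtain ⟨v₀, v₁, v₂, h⟩ := h
  by_cases h₀ : v₀ ∈ t
  · by_cases h₁ : v₁ ∈ t
    · by_cases h₂ : v₂ ∈ t
      · exact Or.inr ⟨v₀, v₁, v₂, h.subset hts h₀ h₁ h₂⟩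
      · exact Or.inl (h.isStandard_erase.2.1.subset (Finset.subset_erase.2 ⟨hts, h₂⟩) ht)
    · exact Or.inl (h.isStandard_erase.1.subset (Finset.subset_erase.2 ⟨hts, h₁⟩) ht)
  · exact Or.inl (h.2.2.2.2.subset (Finset.subset_erase.2 ⟨hts, h₀⟩) ht)

theorem IsSigmaWith.subset {s t : Finset (Line n)} {v w : Line n} (h : IsSigmaWith s v w)
    (hts : t ⊆ s) (hv : v ∈ t) (hw : w ∈ t) : IsSigmaWith t v w := by
  obtain ⟨hv', hw', hx, hu, hs⟩ := h
  have h1 : w ∈ t.erase v := Finset.mem_erase.2 ⟨(Finset.mem_erase.1 hw').1, hw⟩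
  exact ⟨hv, h1, hx, fun u hu' => hu u
    (Finset.erase_subset_erase _ (Finset.erase_subset_erase _ hts) hu'),
    hs.subset (Finset.erase_subset_erase _ hts) ⟨_, h1⟩⟩

theorem IsSigmaWith.isStandard_erase {s : Finset (Line n)} {v w : Line n}
    (h : IsSigmaWith s v w) : IsStandard (s.erase w) := by
  obtain ⟨hv, hw, ⟨x, y, hx, hy, hxy⟩, hu, hs⟩ := h
  obtain ⟨φ, h1, h0⟩ := exists_dual hs.2.2.1 hs.2.2.2
  have hwv := (Finset.mem_erase.1 hw).1
  -- the functional `ε ω(·, y)` is `1` on `x` and vanishes on the other lines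
  obtain ⟨ψ, hψx, hψ⟩ : ∃ ψ : (SymIdx n → ℤ) →ₗ[ℤ] ℤ, ψ x = 1 ∧
      ∀ u ∈ (s.erase v).erase w, ψ (gen u) = 0 := by
    refine ⟨omega x y • omegaLeft y, ?_, fun u hu' => ?_⟩
    · change omega x y * omega x y = 1
      obtain h | h := hxy <;> rw [h] <;> rfl
    · have : omega (gen u) y = 0 :=
        hs.omega_eq_zero (Finset.mem_of_mem_erase hu') hw (generates_gen u).mem hy.mem
      change omega x y * omega (gen u) y = 0
      rw [this, mul_zero]
  have hmem : ∀ u ∈ s.erase w, u ≠ v → u ∈ (s.erase v).erase w := by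
    intro u hu' huv
    rw [Finset.mem_erase] at hu'
    exact Finset.mem_erase.2 ⟨hu'.1, Finset.mem_erase.2 ⟨huv, hu'.2⟩⟩
  refine isStandard_of_dual (g := fun u => if u = v then x else gen u)
    (φ := fun u => if u = v then ψ else φ u - φ u x • ψ)
    ⟨v, Finset.mem_erase.2 ⟨hwv.symm, hv⟩⟩ ?_ ?_ ?_ ?_
  · intro u _
    by_cases huv : u = v
    · simp only [huv, if_true]; exact hx
    · simp only [huv, if_false]; exact generates_gen u
  · intro a ha b hb
    by_cases hav : a = v <;> by_cases hbv : b = v <;> simp only [hav, hbv, if_true, if_false]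
    · exact omega_self x
    · exact hu b (hmem b hb hbv) x hx.mem _ (generates_gen b).mem
    · rw [omega_swap, hu a (hmem a ha hav) x hx.mem _ (generates_gen a).mem, neg_zero]
    · exact hs.omega_eq_zero (Finset.mem_of_mem_erase (hmem a ha hav))
        (Finset.mem_of_mem_erase (hmem b hb hbv)) (generates_gen a).mem (generates_gen b).mem
  · intro a ha
    by_cases hav : a = v
    · simp only [hav, if_true]; exact hψx
    · simp only [hav, if_false, LinearMap.sub_apply, LinearMap.smul_apply]
      rw [hψ a (hmem a ha hav), h1 a (Finset.mem_of_mem_erase (hmem a ha hav)), smul_zero, sub_zero]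
  · intro a ha b hb hab
    by_cases hav : a = v
    · have hbv : b ≠ v := fun h => hab (hav.trans h.symm)
      simp only [hav, hbv, if_true, if_false]
      exact hψ b (hmem b hb hbv)
    · by_cases hbv : b = v
      · simp only [hav, hbv, if_true, if_false, LinearMap.sub_apply, LinearMap.smul_apply]
        rw [hψx, smul_eq_mul, mul_one, sub_self]
      · simp only [hav, hbv, if_false, LinearMap.sub_apply, LinearMap.smul_apply]
        rw [hψ b (hmem b hb hbv), h0 a (Finset.mem_of_mem_erase (hmem a ha hav)) b
          (Finset.mem_of_mem_erase (hmem b hb hbv)) hab, smul_zero, sub_zero]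

theorem IsSigma.subset {s t : Finset (Line n)} (h : IsSigma s) (hts : t ⊆ s)
    (ht : t.Nonempty) : IsStandard t ∨ IsSigma t := by
  obtain ⟨v, w, h⟩ := h
  by_cases hv : v ∈ t
  · by_cases hw : w ∈ t
    · exact Or.inr ⟨v, w, h.subset hts hv hw⟩
    · exact Or.inl (h.isStandard_erase.subset (Finset.subset_erase.2 ⟨hts, hw⟩) ht)
  · exact Or.inl (h.2.2.2.2.subset (Finset.subset_erase.2 ⟨hts, hv⟩) ht)

/-- In a mixed simplex the roles of the three dependent lines can be exchanged. -/
theorem isSigmaWith_erase_of_mixed {s : Finset (Line n)} {v₀ v₁ v₂ v w a b : Line n}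
    (hv₀ : v₀ ∈ s) (hs : IsSigmaWith (s.erase v₀) v w)
    (ht : IsTwoAdditiveWith (s.erase v) v₀ v₁ v₂) (ha : (a = v₁ ∧ b = v₂) ∨ (a = v₂ ∧ b = v₁))
    (hwa : w ≠ a) (hwb : w ≠ b) : IsSigmaWith (s.erase a) v w := by
  obtain ⟨hv, hw, hx, hu, -⟩ := hs
  obtain ⟨x₁, x₂, hx₁, hx₂, hx₀⟩ := ht.2.2.2.1
  have hst : IsStandard ((s.erase v).erase a) := by
    obtain ⟨rfl, -⟩ | ⟨rfl, -⟩ := ha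
    · exact ht.isStandard_erase.1
    · exact ht.isStandard_erase.2.1
  have h1 := ht.2.1
  have h2 := ht.2.2.1
  simp only [Finset.mem_erase] at hv hw h1 h2
  have hu₁ : ∀ x ∈ v.1, omega x x₁ = 0 := fun x hx => hu v₁ (by
    simp only [Finset.mem_erase]
    refine ⟨?_, h1.2.1, h1.1, h1.2.2⟩
    obtain ⟨rfl, -⟩ | ⟨-, rfl⟩ := ha
    · exact hwa.symm
    · exact hwb.symm) x hx x₁ hx₁.mem
  have hu₂ : ∀ x ∈ v.1, omega x x₂ = 0 := fun x hx => hu v₂ (by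
    simp only [Finset.mem_erase]
    refine ⟨?_, h2.2.2.1, h2.2.1, h2.2.2.2⟩
    obtain ⟨-, rfl⟩ | ⟨rfl, -⟩ := ha
    · exact hwb.symm
    · exact hwa.symm) x hx x₂ hx₂.mem
  have hav : a ≠ v := by
    obtain ⟨rfl, -⟩ | ⟨rfl, -⟩ := ha
    · exact h1.2.1
    · exact h2.2.2.1
  refine ⟨?_, ?_, hx, ?_, ?_⟩
  · exact Finset.mem_erase.2 ⟨hav.symm, hv.2⟩
  · simp only [Finset.mem_erase]; exact ⟨hw.1, hwa, hw.2.2⟩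
  · intro u hu' x hx y hy
    simp only [Finset.mem_erase] at hu'
    by_cases huv : u = v₀
    · subst huv
      rw [hx₀, Submodule.mem_span_singleton] at hy
      obtain ⟨c, rfl⟩ := hy
      rw [omega_smul_right, omega_add_right, hu₁ x hx, hu₂ x hx, add_zero, mul_zero]
    · refine hu u ?_ x hx y hy
      simp only [Finset.mem_erase]
      exact ⟨hu'.1, hu'.2.1, huv, hu'.2.2.2⟩
  · rwa [Finset.erase_right_comm]

theorem IsMixed.subset {s t : Finset (Line n)} (h : IsMixed s) (hts : t ⊆ s)
    (ht : t.Nonempty) : IsStandard t ∨ IsTwoAdditive t ∨ IsSigma t ∨ IsMixed t := by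
  obtain ⟨v₀, v₁, v₂, v, w, hv₀, hv, hw₁, hw₂, hσ, hδ⟩ := h
  have sig : ∀ a, IsSigmaWith (s.erase a) v w → a ∉ t →
      IsStandard t ∨ IsTwoAdditive t ∨ IsSigma t ∨ IsMixed t := by
    intro a ha hat
    have := IsSigma.subset ⟨v, w, ha⟩ (Finset.subset_erase.2 ⟨hts, hat⟩) ht
    tauto
  by_cases h : v ∈ t
  swap
  · have := IsTwoAdditive.subset ⟨_, _, _, hδ⟩ (Finset.subset_erase.2 ⟨hts, h⟩) ht
    tauto
  by_cases h₀ : v₀ ∈ t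
  swap
  · exact sig v₀ hσ h₀
  by_cases h₁ : v₁ ∈ t
  swap
  · exact sig v₁ (isSigmaWith_erase_of_mixed hv₀ hσ hδ (Or.inl ⟨rfl, rfl⟩) hw₁ hw₂) h₁
  by_cases h₂ : v₂ ∈ t
  swap
  · exact sig v₂ (isSigmaWith_erase_of_mixed hv₀ hσ hδ (Or.inr ⟨rfl, rfl⟩) hw₂ hw₁) h₂
  have m1 := (Finset.mem_erase.1 hδ.2.1)
  have m2 := (Finset.mem_erase.1 hδ.2.2.1)
  have m2' := (Finset.mem_erase.1 m2.2)
  by_cases h' : w ∈ t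
  · refine Or.inr (Or.inr (Or.inr ⟨v₀, v₁, v₂, v, w, h₀, h, hw₁, hw₂, ?_, ?_⟩))
    · refine hσ.subset (Finset.erase_subset_erase _ hts) ?_ ?_
      · exact Finset.mem_erase.2 ⟨(Finset.mem_erase.1 hσ.1).1, h⟩
      · exact Finset.mem_erase.2
          ⟨(Finset.mem_erase.1 (Finset.mem_of_mem_erase hσ.2.1)).1, h'⟩
    · refine hδ.subset (Finset.erase_subset_erase _ hts) ?_ ?_ ?_
      · exact Finset.mem_erase.2 ⟨(Finset.mem_erase.1 hδ.1).1, h₀⟩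
      · exact Finset.mem_erase.2 ⟨(Finset.mem_erase.1 m1.2).1, h₁⟩
      · exact Finset.mem_erase.2 ⟨(Finset.mem_erase.1 m2'.2).1, h₂⟩
  · have hm1 : v₁ ∈ t.erase v₀ := Finset.mem_erase.2 ⟨m1.1, h₁⟩
    have hm2 : v₂ ∈ (t.erase v₀).erase v₁ :=
      Finset.mem_erase.2 ⟨m2.1, Finset.mem_erase.2 ⟨m2'.1, h₂⟩⟩
    refine Or.inr (Or.inl ⟨v₀, v₁, v₂, h₀, hm1, hm2, hδ.2.2.2.1,
      hσ.isStandard_erase.subset ?_ ⟨_, hm1⟩⟩)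
    rw [Finset.subset_erase]
    exact ⟨Finset.erase_subset_erase _ hts, fun h => h' (Finset.mem_of_mem_erase h)⟩

end

/-! ### The complexes `I^δ`, `IA` and the Tits building -/

/-- The complex `I^δ_n`: its simplices are the standard and the 2-additive simplices. -/
def IDelta (n : ℕ) : AbstractSimplicialComplex (Line n) where
  faces := {s | IsStandard s ∨ IsTwoAdditive s}
  isRelLowerSet_faces := by
    rintro s hs
    refine ⟨?_, fun t hts ht => ?_⟩
    · obtain hs | ⟨v, _, _, hs⟩ := hs
      exacts [hs.1, ⟨v, hs.1⟩]
    · obtain hs | hs := hs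
      exacts [Or.inl (hs.subset hts ht), hs.subset hts ht]
  singleton_mem := fun v => Or.inl (isStandard_singleton v)

/-- The complex `IA_n`: its simplices are the standard, 2-additive, `σ` and mixed simplices. -/
def IA (n : ℕ) : AbstractSimplicialComplex (Line n) where
  faces := {s | IsStandard s ∨ IsTwoAdditive s ∨ IsSigma s ∨ IsMixed s}
  isRelLowerSet_faces := by
    rintro s hs
    refine ⟨?_, fun t hts ht => ?_⟩
    · obtain hs | ⟨v, _, _, hs⟩ | ⟨v, _, hs⟩ | ⟨v, _, _, _, _, hs⟩ := hs
      exacts [hs.1, ⟨v, hs.1⟩, ⟨v, hs.1⟩, ⟨v, hs.1⟩]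
    · obtain hs | hs | hs | hs := hs
      · exact Or.inl (hs.subset hts ht)
      · exact (hs.subset hts ht).imp id Or.inl
      · exact (hs.subset hts ht).imp id fun h => Or.inr (Or.inl h)
      · exact hs.subset hts ht
  singleton_mem := fun v => Or.inl (isStandard_singleton v)

/-- The Tits building `T^ω_n`: nontrivial isotropic subspaces of `ℚ^{2n}`, ordered by inclusion.
(For `n ≥ 1` isotropic subspaces are proper.) -/
abbrev TitsBuilding (n : ℕ) : Type :=
  {V : Submodule ℚ (SymIdx n → ℚ) // V ≠ ⊥ ∧ IsIsotropic V}

/-- The symplectic Steinberg module `St^ω_n = H̃_{n-1}(T^ω_n; ℤ)`. -/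
abbrev Steinberg (n : ℕ) : Type := RedHomology (orderComplex (TitsBuilding n)) n

/-- The rational vector of an integral vector. -/
def toRat {n : ℕ} (x : SymIdx n → ℤ) : SymIdx n → ℚ := fun a => (x a : ℚ)

/-- The rational span `⟨Δ⟩_ℚ` of a finite set of lines. -/
def ratSpan {n : ℕ} (s : Finset (Line n)) : Submodule ℚ (SymIdx n → ℚ) :=
  Submodule.span ℚ (toRat '' (lineSpan s : Set (SymIdx n → ℤ)))

section
variable {n : ℕ}

theorem omega_toRat (x y : SymIdx n → ℤ) : omega (toRat x) (toRat y) = ((omega x y : ℤ) : ℚ) := by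
  simp [omega, toRat]

theorem toRat_injective : Function.Injective (toRat (n := n)) := fun x y h => by
  funext a
  exact Int.cast_injective (α := ℚ) (congrFun h a)

theorem Generates.ne_zero {x : SymIdx n → ℤ} {v : Line n} (h : Generates x v) : x ≠ 0 := by
  rintro rfl
  have h1 := v.2.2
  rw [h, Submodule.span_zero_singleton, finrank_bot] at h1
  exact zero_ne_one h1

theorem isIsotropic_lineSpan {s : Finset (Line n)} (hs : s ∈ (IDelta n).faces) :
    IsIsotropic (lineSpan s) := by
  obtain hs | ⟨v₀, v₁, v₂, hs⟩ := hs
  · exact hs.2.1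
  · rw [hs.isStandard_erase.2.2]
    exact hs.2.2.2.2.2.1

theorem ratSpan_mem {s : Finset (Line n)} (hs : s ∈ (IDelta n).faces) :
    ratSpan s ≠ ⊥ ∧ IsIsotropic (ratSpan s) := by
  constructor
  · obtain ⟨v, hv⟩ := ((IDelta n).isRelLowerSet_faces hs).1
    intro h
    have h1 : toRat (gen v) ∈ ratSpan s :=
      Submodule.subset_span ⟨gen v, le_lineSpan hv (generates_gen v).mem, rfl⟩
    rw [h, Submodule.mem_bot] at h1
    exact (generates_gen v).ne_zero (toRat_injective (h1.trans (by funext a; simp [toRat])))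
  · refine isIsotropic_span ?_
    rintro _ ⟨x, hx, rfl⟩ _ ⟨y, hy, rfl⟩
    rw [omega_toRat, isIsotropic_lineSpan hs x hx y hy, Int.cast_zero]

end

/-- The spanning map `s : P(I^δ_n) → T^ω_n`, `Δ ↦ ⟨Δ⟩_ℚ`. -/
def spanPosetMap (n : ℕ) : FacePoset (IDelta n) →o TitsBuilding n where
  toFun s := ⟨ratSpan s.1, ratSpan_mem s.2⟩
  monotone' := fun _ _ hst => Submodule.span_mono (Set.image_mono (lineSpan_mono hst))

/-- The map `s_* : H̃_{n-1}(P(I^δ_n)) → St^ω_n`. -/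
def spanMap (n : ℕ) : RedHomology (orderComplex (FacePoset (IDelta n))) n →ₗ[ℤ] Steinberg n :=
  redMap (orderComplexMap (spanPosetMap n)) n

/-! ### The complexes `∂β_n` and `β_n` and their fundamental classes -/

/-- Standard subsets of `{1, 1̄, …, n, n̄}`: nonempty subsets that contain no pair `{a, ā}`. -/
def IsStandardSubset {n : ℕ} (I : Finset (SymIdx n)) : Prop :=
  I.Nonempty ∧ ∀ a : Fin n, ¬(Sum.inl a ∈ I ∧ Sum.inr a ∈ I)

/-- `σ` subsets of `{1, 1̄, …, n, n̄}`: subsets that contain the pair `{n, n̄}` and no other pair. -/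
def IsSigmaSubset {n : ℕ} (I : Finset (SymIdx n)) : Prop :=
  (∃ l : Fin n, (l : ℕ) + 1 = n ∧ Sum.inl l ∈ I ∧ Sum.inr l ∈ I) ∧
    ∀ a : Fin n, (a : ℕ) + 1 < n → ¬(Sum.inl a ∈ I ∧ Sum.inr a ∈ I)

/-- The simplicial sphere `∂β_n`. -/
def bdryBeta (n : ℕ) : AbstractSimplicialComplex (SymIdx n) where
  faces := {I | IsStandardSubset I}
  isRelLowerSet_faces := fun _ hI =>
    ⟨hI.1, fun _ hJI hJ => ⟨hJ, fun a ha => hI.2 a ⟨hJI ha.1, hJI ha.2⟩⟩⟩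
  singleton_mem := fun v => ⟨Finset.singleton_nonempty v, fun a ha => by
    have h1 := Finset.mem_singleton.1 ha.1
    have h2 := Finset.mem_singleton.1 ha.2
    rw [← h2] at h1
    cases h1⟩

/-- The simplicial disc `β_n`. -/
def beta (n : ℕ) : AbstractSimplicialComplex (SymIdx n) where
  faces := {I | IsStandardSubset I ∨ IsSigmaSubset I}
  isRelLowerSet_faces := by
    rintro I hI
    refine ⟨?_, fun J hJI hJ => ?_⟩
    · obtain hI | ⟨⟨l, _, hl, _⟩, _⟩ := hI
      exacts [hI.1, ⟨_, hl⟩]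
    · obtain hI | ⟨_, hI⟩ := hI
      · exact Or.inl ⟨hJ, fun a ha => hI.2 a ⟨hJI ha.1, hJI ha.2⟩⟩
      · by_cases h : ∃ l : Fin n, (l : ℕ) + 1 = n ∧ Sum.inl l ∈ J ∧ Sum.inr l ∈ J
        · exact Or.inr ⟨h, fun a ha ha' => hI a ha ⟨hJI ha'.1, hJI ha'.2⟩⟩
        · refine Or.inl ⟨hJ, fun a ha => ?_⟩
          by_cases h' : (a : ℕ) + 1 < n
          · exact hI a h' ⟨hJI ha.1, hJI ha.2⟩
          · exact h ⟨a, by omega, ha⟩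
  singleton_mem := fun v => Or.inl ((bdryBeta n).singleton_mem v)

theorem bdryBeta_le_beta (n : ℕ) : bdryBeta n ≤ beta n := fun _ h => Or.inl h

theorem cone_mem_chains {ι : Type*} {X Y : AbstractSimplicialComplex ι} {a : ι}
    (h : ∀ s ∈ X.faces, ∃ u ∈ Y.faces, a ∈ u ∧ s ⊆ u) {k : ℕ} {c : Chains ι k}
    (hc : c ∈ chains X k) : cone a k c ∈ chains Y (k + 1) := by
  have : chains X k ≤ (chains Y (k + 1)).comap (cone a k) := by
    rw [chains_le_iff]
    intro t ht
    rw [Submodule.mem_comap, cone_single]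
    refine single_mem_chains Y ?_ _
    obtain rfl | ⟨s, hs, hst⟩ := ht
    · refine Or.inr ⟨{a}, Y.singleton_mem a, fun i => ?_⟩
      refine Fin.cases ?_ (fun j => j.elim0) i
      simp
    · obtain ⟨u, hu, hau, hsu⟩ := h s hs
      refine Or.inr ⟨u, hu, fun i => ?_⟩
      refine Fin.cases ?_ (fun j => ?_) i
      · simpa using hau
      · simpa using hsu (hst j)
  exact this hc

/-- `β_n` is a cone with apex `n`, for `n ≥ 1`. -/
theorem beta_cone (n : ℕ) (hn : 1 ≤ n) : ∀ s ∈ (beta n).faces, ∃ u ∈ (beta n).faces,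
    (Sum.inl ⟨n - 1, by omega⟩ : SymIdx n) ∈ u ∧ s ⊆ u := by
  intro s hs
  refine ⟨insert (Sum.inl ⟨n - 1, by omega⟩) s, ?_, Finset.mem_insert_self _ _,
    Finset.subset_insert _ _⟩
  have key : ∀ a : Fin n, (a : ℕ) + 1 < n →
      ¬(Sum.inl a ∈ insert (Sum.inl ⟨n - 1, by omega⟩ : SymIdx n) s ∧
        Sum.inr a ∈ insert (Sum.inl ⟨n - 1, by omega⟩ : SymIdx n) s) := by
    intro a ha hm
    rw [Finset.mem_insert, Finset.mem_insert] at hm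
    have h1 : Sum.inl a ∈ s := hm.1.resolve_left fun h => by
      have := congrArg Fin.val (Sum.inl_injective h)
      simp only at this
      omega
    have h2 : Sum.inr a ∈ s := hm.2.resolve_left (by simp)
    obtain hs | hs := hs
    · exact hs.2 a ⟨h1, h2⟩
    · exact hs.2 a ha ⟨h1, h2⟩
  by_cases h : (Sum.inr ⟨n - 1, by omega⟩ : SymIdx n) ∈ s
  · refine Or.inr ⟨⟨⟨n - 1, by omega⟩, by simp only; omega, Finset.mem_insert_self _ _,
      Finset.mem_insert_of_mem h⟩, key⟩
  · refine Or.inl ⟨Finset.insert_nonempty _ _, fun a ha => ?_⟩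
    by_cases h' : (a : ℕ) + 1 < n
    · exact key a h' ha
    · have : a = ⟨n - 1, by omega⟩ := Fin.ext (by simp only; omega)
      rw [this] at ha
      exact h ((Finset.mem_insert.1 ha.2).resolve_left (by simp))

/-- In a complex that is a cone, every reduced cycle bounds its cone. -/
theorem bdry_cone_of_cycle {ι : Type*} {X : AbstractSimplicialComplex ι} {a : ι} {k : ℕ}
    {c : Chains ι k} (hc : c ∈ cycles X k) : bdry k (cone a k c) = c := by
  cases k with
  | zero => exact bdry_cone_zero a c
  | succ k =>
    have h : bdry k c = 0 := hc.2
    rw [bdry_cone_succ, h, map_zero, sub_zero]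

/-- The connecting morphism of the disc `(β_n, ∂β_n)` is an isomorphism. -/
theorem connecting_beta_bijective (n : ℕ) (hn : 1 ≤ n) :
    Function.Bijective (connecting (beta n) (bdryBeta n) n) := by
  constructor
  · rw [injective_iff_map_eq_zero]
    intro x
    obtain ⟨⟨c, hc⟩, rfl⟩ := Submodule.Quotient.mk_surjective _ x
    intro h
    have h' : bdry n c ∈ boundaries (bdryBeta n) n :=
      (Submodule.Quotient.mk_eq_zero
        ((boundaries (bdryBeta n) n).submoduleOf (cycles (bdryBeta n) n))).1
        (show Submodule.Quotient.mk (⟨bdry n c, bdry_mem_cycles _ hc.2⟩ :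
          cycles (bdryBeta n) n) = 0 from h)
    obtain ⟨a, ha, hac⟩ := h'
    refine (Submodule.Quotient.mk_eq_zero _).2 ?_
    change c ∈ relBoundaries (beta n) (bdryBeta n) n
    have hz : c - a ∈ cycles (beta n) (n + 1) :=
      ⟨Submodule.sub_mem _ hc.1 (chains_mono (bdryBeta_le_beta n) _ ha), by
        change bdry n (c - a) = 0
        rw [map_sub, hac, sub_self]⟩
    have e : c = bdry (n + 1) (cone (Sum.inl ⟨n - 1, by omega⟩) (n + 1) (c - a)) + a := by
      rw [bdry_cone_of_cycle hz, sub_add_cancel]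
    rw [e]
    exact Submodule.add_mem_sup ⟨_, cone_mem_chains (beta_cone n hn) hz.1, rfl⟩ ha
  · intro x
    obtain ⟨⟨z, hz⟩, rfl⟩ := Submodule.Quotient.mk_surjective _ x
    have e : bdry n (cone (Sum.inl ⟨n - 1, by omega⟩) n z) = z := bdry_cone_of_cycle hz
    have hz' := cycles_le_chains _ _ hz
    have hmem : cone (Sum.inl ⟨n - 1, by omega⟩) n z ∈ relCycles (beta n) (bdryBeta n) n := by
      refine ⟨cone_mem_chains (beta_cone n hn) (chains_mono (bdryBeta_le_beta n) _ hz'), ?_⟩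
      change bdry n _ ∈ chains (bdryBeta n) n
      rw [e]
      exact hz'
    refine ⟨Submodule.Quotient.mk ⟨_, hmem⟩, ?_⟩
    have e' : (⟨bdry n _, bdry_mem_cycles _ hmem.2⟩ : cycles (bdryBeta n) n) = ⟨z, hz⟩ :=
      Subtype.ext e
    rw [← e']
    rfl

/-- The connecting isomorphism `H_n(β_n, ∂β_n) ≅ H̃_{n-1}(∂β_n)` for `n ≥ 1`. -/
def connectingBeta (n : ℕ) (hn : 1 ≤ n) :
    RelHomology (beta n) (bdryBeta n) n ≃ₗ[ℤ] RedHomology (bdryBeta n) n :=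
  LinearEquiv.ofBijective (connecting (beta n) (bdryBeta n) n) (connecting_beta_bijective n hn)

/-- The inclusion `{1, 1̄, …, n, n̄} ⊆ {1, 1̄, …, n + 1, (n + 1)‾}`. -/
def symIncl (n : ℕ) : SymIdx n → SymIdx (n + 1) := Sum.map Fin.castSucc Fin.castSucc

/-- The inclusion `∂β_n → ∂β_{n+1}`. -/
def bdryBetaIncl (n : ℕ) : SimplicialMap (bdryBeta n) (bdryBeta (n + 1)) where
  toFun := symIncl n
  image_mem := fun I hI => by
    refine ⟨I.image (symIncl n), ⟨hI.1.image _, fun a ha => ?_⟩, Finset.coe_image⟩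
    obtain ⟨x, hx, hxa⟩ := Finset.mem_image.1 ha.1
    obtain ⟨y, hy, hya⟩ := Finset.mem_image.1 ha.2
    obtain x | x := x <;> obtain y | y := y <;> simp [symIncl] at hxa hya
    have : x = y := Fin.castSucc_injective _ (hxa.trans hya.symm)
    subst this
    exact hI.2 x ⟨hx, hy⟩

/-- On chains, the suspension `z ↦ N * z - S * z` with the suspension points `N = n + 1` and
`S = (n + 1)‾` of `∂β_{n+1} = ∂β_n * {N, S}`. -/
def suspendChain (n k : ℕ) : Chains (SymIdx n) k →ₗ[ℤ] Chains (SymIdx (n + 1)) (k + 1) :=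
  (cone (Sum.inl (Fin.last n)) k - cone (Sum.inr (Fin.last n)) k).comp (push (symIncl n) k)

theorem suspendChain_mem (n k : ℕ) {c : Chains (SymIdx n) k} (hc : c ∈ chains (bdryBeta n) k) :
    suspendChain n k c ∈ chains (bdryBeta (n + 1)) (k + 1) := by
  -- the image of `∂β_n` is contained in the subcomplex of simplices without suspension points
  have hb : ∀ N : SymIdx (n + 1), (N = Sum.inl (Fin.last n) ∨ N = Sum.inr (Fin.last n)) →
      cone N k (push (symIncl n) k c) ∈ chains (bdryBeta (n + 1)) (k + 1) := by
    intro N hN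
    have : chains (bdryBeta n) k ≤ (chains (bdryBeta (n + 1)) (k + 1)).comap
        ((cone N k).comp (push (symIncl n) k)) := by
      rw [chains_le_iff]
      intro t ht
      rw [Submodule.mem_comap, LinearMap.comp_apply, push_single, cone_single]
      refine single_mem_chains _ ?_ _
      have hmem : ∀ I : Finset (SymIdx n), (∀ a : Fin n, ¬(Sum.inl a ∈ I ∧ Sum.inr a ∈ I)) →
          insert N (I.image (symIncl n)) ∈ (bdryBeta (n + 1)).faces := by
        intro I hI
        refine ⟨Finset.insert_nonempty _ _, fun a ha => ?_⟩
        rw [Finset.mem_insert, Finset.mem_insert, Finset.mem_image, Finset.mem_image] at ha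
        obtain ⟨h1, h2⟩ := ha
        refine Fin.lastCases (fun h1 h2 => ?_) (fun b h1 h2 => ?_) a h1 h2
        · have e1 : ¬∃ x ∈ I, symIncl n x = Sum.inl (Fin.last n) := by
            rintro ⟨x | x, _, hx⟩ <;> simp [symIncl, Fin.ext_iff] at hx
            have := x.2
            omega
          have e2 : ¬∃ x ∈ I, symIncl n x = Sum.inr (Fin.last n) := by
            rintro ⟨x | x, _, hx⟩ <;> simp [symIncl, Fin.ext_iff] at hx
            have := x.2
            omega
          have := (h1.resolve_right e1).trans (h2.resolve_right e2).symm
          cases this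
        · have e1 : (Sum.inl b.castSucc : SymIdx (n + 1)) ≠ N := by
            rintro rfl
            simp [Fin.ext_iff] at hN
            have := b.2
            omega
          have e2 : (Sum.inr b.castSucc : SymIdx (n + 1)) ≠ N := by
            rintro rfl
            simp [Fin.ext_iff] at hN
            have := b.2
            omega
          obtain ⟨x, hx, hxb⟩ := h1.resolve_left e1
          obtain ⟨y, hy, hyb⟩ := h2.resolve_left e2
          obtain x | x := x <;> obtain y | y := y <;> simp [symIncl] at hxb hyb
          rw [hxb] at hx
          rw [hyb] at hy
          exact hI b ⟨hx, hy⟩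
      obtain rfl | ⟨s, hs, hst⟩ := ht
      · refine Or.inr ⟨_, hmem ∅ (by simp), fun i => ?_⟩
        refine Fin.cases ?_ (fun j => j.elim0) i
        simp
      · refine Or.inr ⟨_, hmem s hs.2, fun i => ?_⟩
        refine Fin.cases ?_ (fun j => ?_) i
        · simp
        · rw [Fin.cons_succ]
          exact Finset.mem_insert_of_mem (Finset.mem_image_of_mem _ (hst j))
    exact this hc
  rw [suspendChain, LinearMap.comp_apply, LinearMap.sub_apply]
  exact Submodule.sub_mem _ (hb _ (Or.inl rfl)) (hb _ (Or.inr rfl))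

theorem bdry_suspendChain (n k : ℕ) (c : Chains (SymIdx n) (k + 1)) :
    bdry (k + 1) (suspendChain n (k + 1) c) = -suspendChain n k (bdry k c) := by
  simp only [suspendChain, LinearMap.comp_apply, LinearMap.sub_apply, map_sub, bdry_cone_succ,
    bdry_push]
  abel

/-- The suspension isomorphism `H̃_{n-1}(∂β_n) → H̃_n(∂β_{n+1})`. -/
def suspension (n : ℕ) : RedHomology (bdryBeta n) n →ₗ[ℤ] RedHomology (bdryBeta (n + 1)) (n + 1) :=
  Submodule.mapQ _ _
    ((suspendChain n n).restrict (p := cycles (bdryBeta n) n)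
      (q := cycles (bdryBeta (n + 1)) (n + 1)) fun c hc =>
        ⟨suspendChain_mem n n (cycles_le_chains _ _ hc), by
          change bdry n _ = 0
          rw [suspendChain, LinearMap.comp_apply, LinearMap.sub_apply, map_sub,
            bdry_cone_of_cycle (show push (symIncl n) n c ∈ cycles (bdryBeta (n + 1)) n from
              push_mem_cycles (bdryBetaIncl n) hc),
            bdry_cone_of_cycle (show push (symIncl n) n c ∈ cycles (bdryBeta (n + 1)) n from
              push_mem_cycles (bdryBetaIncl n) hc), sub_self]⟩)
    (by
      rintro ⟨c, hc⟩ ⟨x, hx, hxc⟩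
      refine ⟨-suspendChain n (n + 1) x,
        Submodule.neg_mem _ (suspendChain_mem n (n + 1) hx), ?_⟩
      rw [map_neg, bdry_suspendChain, neg_neg, hxc]
      rfl)

/-- The fundamental class `ξ_{n-1} ∈ H̃_{n-1}(∂β_n)` for `n ≥ 1`, obtained by suspension from a
fundamental class `ξ₀ ∈ H̃_0(∂β_1)`. (The value for `n = 0` is not used.) -/
def fundamentalClass (ξ₀ : RedHomology (bdryBeta 1) 1) : (n : ℕ) → RedHomology (bdryBeta n) n
  | 0 => 0
  | 1 => ξ₀
  | n + 2 => suspension (n + 1) (fundamentalClass ξ₀ (n + 1))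

/-! ### Symplectic matrices, apartments and the maps of the diagram -/

/-- The integral symplectic group `Sp_{2n}(ℤ)`. -/
abbrev Sp (n : ℕ) : Type := Matrix.symplecticGroup (Fin n) ℤ

/-- The column vector of `M` with index `a`. -/
def column {n : ℕ} (M : Sp n) (a : SymIdx n) : SymIdx n → ℤ := fun b => M.1 b a

section
variable {n : ℕ}

theorem omega_eq_dotProduct {R : Type*} [CommRing R] (x y : SymIdx n → R) :
    omega x y = -(x ⬝ᵥ (Matrix.J (Fin n) R).mulVec y) := by
  simp [omega, Matrix.J, Matrix.mulVec, dotProduct, Matrix.fromBlocks, Fintype.sum_sum_type,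
    Matrix.one_apply, Finset.sum_sub_distrib]
  ring

theorem omega_column (M : Sp n) (a b : SymIdx n) :
    omega (column M a) (column M b) = -(Matrix.J (Fin n) ℤ a b) := by
  rw [omega_eq_dotProduct]
  congr 1
  have h := SymplecticGroup.mem_iff'.1 M.2
  have h' := congrFun (congrFun h a) b
  rw [← h', Matrix.mul_assoc, Matrix.mul_apply]
  rfl

/-- The conjugate index `a ↦ ā`. -/
def bar : SymIdx n → SymIdx n := Sum.swap

theorem omega_column_of_ne (M : Sp n) {a b : SymIdx n} (h : b ≠ bar a) :
    omega (column M a) (column M b) = 0 := by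
  rw [omega_column, neg_eq_zero]
  obtain a | a := a <;> obtain b | b := b <;>
    simp [bar, Matrix.J] at h ⊢
  · exact Matrix.one_apply_ne (Ne.symm h)
  · exact Matrix.one_apply_ne (Ne.symm h)

theorem omega_column_bar (M : Sp n) (a : SymIdx n) :
    omega (column M a) (column M (bar a)) = 1 ∨ omega (column M a) (column M (bar a)) = -1 := by
  rw [omega_column]
  obtain a | a := a <;> simp [bar, Matrix.J]

theorem bar_bar (a : SymIdx n) : bar (bar a) = a := Sum.swap_swap a

theorem exists_dual_column (M : Sp n) (a : SymIdx n) : ∃ φ : (SymIdx n → ℤ) →ₗ[ℤ] ℤ,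
    φ (column M a) = 1 ∧ ∀ b, b ≠ a → φ (column M b) = 0 := by
  refine ⟨omega (column M a) (column M (bar a)) • omegaLeft (column M (bar a)), ?_, ?_⟩
  · change omega (column M a) (column M (bar a)) * omega (column M a) (column M (bar a)) = 1
    obtain h | h := omega_column_bar M a <;> rw [h] <;> rfl
  · intro b hb
    change omega (column M a) (column M (bar a)) * omega (column M b) (column M (bar a)) = 0
    rw [omega_column_of_ne M (a := b), mul_zero]
    intro h
    exact hb (by rw [← bar_bar b, ← h, bar_bar])

end

/-- The line `⟨M_a⟩_ℤ` spanned by a column of `M`. -/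
def columnLine {n : ℕ} (M : Sp n) (a : SymIdx n) : Line n :=
  ⟨Submodule.span ℤ {column M a}, by
    obtain ⟨φ, h1, -⟩ := exists_dual_column M a
    have := summand_of_dual (s := {a}) (g := column M) (φ := fun _ => φ)
      (fun v hv => by rw [Finset.mem_singleton.1 hv, h1])
      (fun v hv w hw h =>
        (h ((Finset.mem_singleton.1 hv).trans (Finset.mem_singleton.1 hw).symm)).elim)
    rwa [Finset.coe_singleton, Set.image_singleton, Finset.card_singleton] at this⟩

section
variable {n : ℕ}

theorem generates_column (M : Sp n) (a : SymIdx n) : Generates (column M a) (columnLine M a) := rfl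

theorem columnLine_injective (M : Sp n) : Function.Injective (columnLine M) := by
  intro a b h
  by_contra hab
  obtain ⟨φ, h1, h0⟩ := exists_dual_column M a
  have : column M a ∈ (columnLine M b).1 := h ▸ (generates_column M a).mem
  rw [generates_column M b, Submodule.mem_span_singleton] at this
  obtain ⟨c, hc⟩ := this
  rw [← hc, map_smul, h0 b (Ne.symm hab), smul_zero] at h1
  exact zero_ne_one h1

theorem isStandard_columns (M : Sp n) {I : Finset (SymIdx n)} (hI : IsStandardSubset I) :
    IsStandard (I.image (columnLine M)) := by
  choose φ h1 h0 using exists_dual_column M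
  have : Nonempty (SymIdx n) := ⟨hI.1.choose⟩
  have inv : ∀ a, Function.invFun (columnLine M) (columnLine M a) = a :=
    Function.leftInverse_invFun (columnLine_injective M)
  have hbar : ∀ a ∈ I, ∀ b ∈ I, b ≠ bar a := by
    rintro (a | a) ha _ hb rfl
    · exact hI.2 a ⟨ha, hb⟩
    · exact hI.2 a ⟨hb, ha⟩
  refine isStandard_of_dual (g := fun v => column M (Function.invFun (columnLine M) v))
    (φ := fun v => φ (Function.invFun (columnLine M) v)) (hI.1.image _) ?_ ?_ ?_ ?_
  · intro v hv
    obtain ⟨a, _, rfl⟩ := Finset.mem_image.1 hv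
    simp only [inv]
    exact generates_column M a
  · intro v hv w hw
    obtain ⟨a, ha, rfl⟩ := Finset.mem_image.1 hv
    obtain ⟨b, hb, rfl⟩ := Finset.mem_image.1 hw
    simp only [inv]
    exact omega_column_of_ne M (hbar a ha b hb)
  · intro v hv
    obtain ⟨a, _, rfl⟩ := Finset.mem_image.1 hv
    simp only [inv]
    exact h1 a
  · intro v hv w hw hvw
    obtain ⟨a, ha, rfl⟩ := Finset.mem_image.1 hv
    obtain ⟨b, hb, rfl⟩ := Finset.mem_image.1 hw
    simp only [inv]
    exact h0 a b fun h => hvw (by rw [h])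

theorem isSigma_columns (M : Sp n) {I : Finset (SymIdx n)} (hI : IsSigmaSubset I) :
    IsSigma (I.image (columnLine M)) := by
  obtain ⟨⟨l, hl, hl1, hl2⟩, hI⟩ := hI
  have inj := columnLine_injective M
  refine ⟨columnLine M (Sum.inr l), columnLine M (Sum.inl l), Finset.mem_image_of_mem _ hl2, ?_,
    ⟨_, _, generates_column M _, generates_column M _, omega_column_bar M (Sum.inr l)⟩, ?_, ?_⟩
  · refine Finset.mem_erase.2 ⟨fun h => ?_, Finset.mem_image_of_mem _ hl1⟩
    exact Sum.inl_ne_inr (inj h)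
  · intro u hu x hx y hy
    simp only [Finset.mem_erase] at hu
    obtain ⟨b, hb, rfl⟩ := Finset.mem_image.1 hu.2.2
    rw [generates_column M, Submodule.mem_span_singleton] at hx hy
    obtain ⟨c, rfl⟩ := hx
    obtain ⟨d, rfl⟩ := hy
    rw [omega_smul_left, omega_smul_right, omega_column_of_ne M, mul_zero, mul_zero]
    rintro rfl
    exact hu.1 rfl
  · have : (I.image (columnLine M)).erase (columnLine M (Sum.inr l)) =
        (I.erase (Sum.inr l)).image (columnLine M) := by
      rw [Finset.image_erase inj]
    rw [this]
    refine isStandard_columns M ⟨⟨Sum.inl l, Finset.mem_erase.2 ⟨by simp, hl1⟩⟩, fun a ha => ?_⟩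
    by_cases h : (a : ℕ) + 1 < n
    · exact hI a h ⟨Finset.mem_of_mem_erase ha.1, Finset.mem_of_mem_erase ha.2⟩
    · have : a = l := Fin.ext (by omega)
      subst this
      exact (Finset.mem_erase.1 ha.2).1 rfl

end

/-- The simplicial map `M^α : β_n → IA_n`, `a ↦ ⟨M_a⟩_ℤ`. -/
def discMap {n : ℕ} (M : Sp n) : SimplicialMap (beta n) (IA n) where
  toFun := columnLine M
  image_mem := fun I hI => ⟨I.image (columnLine M),
    hI.elim (fun h => Or.inl (isStandard_columns M h))
      fun h => Or.inr (Or.inr (Or.inl (isSigma_columns M h))), Finset.coe_image⟩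

/-- The simplicial map `∂M^α : ∂β_n → I^δ_n`, the restriction of `M^α`. -/
def sphereMap {n : ℕ} (M : Sp n) : SimplicialMap (bdryBeta n) (IDelta n) where
  toFun := columnLine M
  image_mem := fun I hI =>
    ⟨I.image (columnLine M), Or.inl (isStandard_columns M hI), Finset.coe_image⟩

/-- The poset map `∂M : P(∂β_n) → T^ω_n`, `I ↦ M_I = ⟨M_a : a ∈ I⟩_ℚ`. -/
def apartmentMap {n : ℕ} (M : Sp n) : FacePoset (bdryBeta n) →o TitsBuilding n where
  toFun I := ⟨Submodule.span ℚ ((fun a => toRat (column M a)) '' (I.1 : Set (SymIdx n))), by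
    obtain ⟨I, hI⟩ := I
    constructor
    · obtain ⟨a, ha⟩ := hI.1
      intro h
      have h1 : toRat (column M a) ∈
          Submodule.span ℚ ((fun a => toRat (column M a)) '' (I : Set (SymIdx n))) :=
        Submodule.subset_span ⟨a, ha, rfl⟩
      rw [h, Submodule.mem_bot] at h1
      exact (generates_column M a).ne_zero
        (toRat_injective (h1.trans (by funext a; simp [toRat])))
    · refine isIsotropic_span ?_
      rintro _ ⟨a, ha, rfl⟩ _ ⟨b, hb, rfl⟩
      change omega (toRat (column M a)) (toRat (column M b)) = 0
      rw [omega_toRat, omega_column_of_ne M, Int.cast_zero]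
      rintro rfl
      obtain a | a := a
      · exact hI.2 a ⟨ha, hb⟩
      · exact hI.2 a ⟨hb, ha⟩⟩
  monotone' := fun _ _ hIJ => Submodule.span_mono (Set.image_mono (Finset.coe_subset.2 hIJ))

/-- The `ℤ`-linear extension to the group ring `ℤ[Sp_{2n}(ℤ)]` of a map on `Sp_{2n}(ℤ)`. -/
def extendLinearly {n : ℕ} {A : Type*} [AddCommGroup A] (f : Sp n → A) :
    MonoidAlgebra ℤ (Sp n) →ₗ[ℤ] A :=
  (Finsupp.linearCombination ℤ f).comp (MonoidAlgebra.coeffLinearEquiv ℤ).toLinearMap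

/-- The symplectic integral apartment class map `[-] : ℤ[Sp_{2n}(ℤ)] → St^ω_n`,
`[M] = ∂M_*(b(ξ))`. -/
def apartmentClassMap (n : ℕ) (ξ₀ : RedHomology (bdryBeta 1) 1) :
    MonoidAlgebra ℤ (Sp n) →ₗ[ℤ] Steinberg n :=
  extendLinearly fun M => redMap (orderComplexMap (apartmentMap M)) n
    (subdivision (bdryBeta n) n (fundamentalClass ξ₀ n))

/-- The map `α : ℤ[Sp_{2n}(ℤ)] → H_n(IA_n, I^δ_n)`: the image of `ξ ∈ H̃_{n-1}(∂β_n)` under the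
inverse of the connecting isomorphism of `(β_n, ∂β_n)`, followed by `(M^α, ∂M^α)_*`. -/
def alpha (n : ℕ) (hn : 1 ≤ n) (ξ₀ : RedHomology (bdryBeta 1) 1) :
    MonoidAlgebra ℤ (Sp n) →ₗ[ℤ] RelHomology (IA n) (IDelta n) n :=
  extendLinearly fun M => relMap (discMap M) (sphereMap M) rfl n
    ((connectingBeta n hn).symm (fundamentalClass ξ₀ n))

end SymplecticApartments

end

open SymplecticApartments

/-!
The map `b` is invertible because choosing a vertex of each simplex gives a simplicial map
`φ : sd X → X`, and both `φ_* ∘ b` and `b ∘ φ_*` differ from the identity by a chain map carried by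
cones: the first by the simplices themselves, the second by the sets of faces lying below a given
one. Such a chain map is contracted by coning off, simplex by simplex.

For the factorization, naturality of the connecting morphism and of `b` lets both be computed on the
model disc, where `δ` undoes the choice of a preimage of `ξ`. What remains is that the poset map
`∂M : P(∂β_n) → T^ω_n` is the composite of `P(∂β_n) → P(I^δ_n)` and the spanning map.
-/

namespace SymplecticApartments

section ConicalCarrier
variable {ι κ : Type*} {X : AbstractSimplicialComplex ι} {Y : AbstractSimplicialComplex κ}

theorem coe_spanSimplex {k : ℕ} {t : Fin (k + 1) → ι} (ht : Spans X t) :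
    ((spanSimplex X t ht).1 : Set ι) = Set.range t := by
  simp [spanSimplex]

theorem apply_mem_spanSimplex {k : ℕ} {t : Fin (k + 1) → ι} (ht : Spans X t) (i : Fin (k + 1)) :
    t i ∈ (spanSimplex X t ht).1 := by
  simp [spanSimplex]

theorem spanSimplex_omit_le {k : ℕ} {t : Fin (k + 2) → ι} (ht : Spans X t) (i : Fin (k + 2)) :
    spanSimplex X (fun j => t (i.succAbove j)) (spans_omit X ht i) ≤ spanSimplex X t ht := by
  refine Finset.coe_subset.1 ?_
  rw [coe_spanSimplex, coe_spanSimplex]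
  exact Set.range_comp_subset_range i.succAbove t

theorem eqOn_chains {M : Type*} [AddCommGroup M] {k : ℕ} {f g : Chains ι k →ₗ[ℤ] M}
    (h : ∀ t, Spans X t → f (Finsupp.single t 1) = g (Finsupp.single t 1)) :
    Set.EqOn f g (chains X k) :=
  (chains_le_iff X (p := LinearMap.eqLocus f g)).2 h

theorem map_bdry_single_mem {M : Type*} [AddCommGroup M] {k : ℕ} {f : Chains ι k →ₗ[ℤ] M}
    {p : Submodule ℤ M} {t : Fin (k + 1) → ι}
    (h : ∀ i : Fin (k + 1), f (Finsupp.single (fun j => t (i.succAbove j)) 1) ∈ p) :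
    f (bdry k (Finsupp.single t 1)) ∈ p := by
  rw [bdry_single, map_sum]
  refine Submodule.sum_mem _ fun i _ => ?_
  rw [← mul_one ((-1 : ℤ) ^ (i : ℕ)), ← smul_eq_mul, ← Finsupp.smul_single, map_smul]
  exact p.smul_mem _ (h i)

/-- The chains of the full subcomplex of `Y` on the vertex set `S`, in degree `k - 1`. -/
noncomputable def chainsOn (Y : AbstractSimplicialComplex κ) (S : Set κ) (k : ℕ) :
    Submodule ℤ (Chains κ k) :=
  chains Y k ⊓ Finsupp.supported ℤ ℤ {t | ∀ i, t i ∈ S}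

theorem single_mem_chainsOn {S : Set κ} {k : ℕ} {t : Fin k → κ} (ht : Spans Y t)
    (hS : ∀ i, t i ∈ S) : Finsupp.single t 1 ∈ chainsOn Y S k :=
  ⟨single_mem_chains Y ht 1, Finsupp.single_mem_supported ℤ 1 hS⟩

theorem chainsOn_mono {S T : Set κ} (h : S ⊆ T) (k : ℕ) : chainsOn Y S k ≤ chainsOn Y T k :=
  inf_le_inf_left _ (Finsupp.supported_mono fun _ ht i => h (ht i))

/-- The full subcomplex of `Y` on the vertex set `S` is a cone with apex `a`. -/
def IsConeApex (Y : AbstractSimplicialComplex κ) (S : Set κ) (a : κ) : Prop :=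
  a ∈ S ∧ ∀ s ∈ Y.faces, (s : Set κ) ⊆ S → ∃ u ∈ Y.faces, a ∈ u ∧ s ⊆ u

theorem IsConeApex.spans_cons {S : Set κ} {a : κ} (h : IsConeApex Y S a) {k : ℕ} {t : Fin k → κ}
    (ht : Spans Y t) (hS : ∀ i, t i ∈ S) : Spans Y (Fin.cons a t : Fin (k + 1) → κ) := by
  obtain _ | k := k
  · refine Or.inr ⟨{a}, Y.singleton_mem a, Fin.cases ?_ fun i => i.elim0⟩
    exact Finset.mem_singleton_self a
  · have hsub : ((spanSimplex Y t ht).1 : Set κ) ⊆ S := by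
      rw [coe_spanSimplex]
      exact Set.range_subset_iff.2 hS
    obtain ⟨u, hu, hau, htu⟩ := h.2 _ (spanSimplex Y t ht).2 hsub
    exact Or.inr ⟨u, hu, Fin.cases hau fun i => htu (apply_mem_spanSimplex ht i)⟩

theorem IsConeApex.cone_mem_chainsOn {S : Set κ} {a : κ} (h : IsConeApex Y S a) {k : ℕ}
    {c : Chains κ k} (hc : c ∈ chainsOn Y S k) : cone a k c ∈ chainsOn Y S (k + 1) := by
  rw [chainsOn, chains, ← Finsupp.supported_inter] at hc ⊢
  refine Finsupp.supported_comap_lmapDomain ℤ ℤ _ _ (Finsupp.supported_mono ?_ hc)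
  rintro t ⟨ht, hS⟩
  exact ⟨h.spans_cons ht hS, Fin.cases h.1 hS⟩

open Classical in
/-- The chain homotopy that contracts a chain map `d` vanishing in degree `-1`: a simplex `s` is
sent to the cone, from the apex `a s`, over what remains of `d s` after the contraction of its
boundary. (Tuples that do not span a simplex of `X` are sent to `0`.) -/
noncomputable def contraction (X : AbstractSimplicialComplex ι) (a : FacePoset X → κ)
    (d : ∀ k, Chains ι k →ₗ[ℤ] Chains κ k) : (k : ℕ) → Chains ι k →ₗ[ℤ] Chains κ (k + 1)
  | 0 => 0
  | k + 1 => Finsupp.linearCombination ℤ fun t : Fin (k + 1) → ι =>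
      if ht : Spans X t then
        cone (a (spanSimplex X t ht)) (k + 1) (d (k + 1) (Finsupp.single t 1) -
          contraction X a d k (bdry k (Finsupp.single t 1)))
      else 0

variable {a : FacePoset X → κ} {d : ∀ k, Chains ι k →ₗ[ℤ] Chains κ k}

theorem contraction_single {k : ℕ} {t : Fin (k + 1) → ι} (ht : Spans X t) :
    contraction X a d (k + 1) (Finsupp.single t 1) =
      cone (a (spanSimplex X t ht)) (k + 1) (d (k + 1) (Finsupp.single t 1) -
        contraction X a d k (bdry k (Finsupp.single t 1))) := by
  rw [contraction, Finsupp.linearCombination_single, one_smul, dif_pos ht]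

theorem bdry_contraction (hd₀ : d 0 = 0)
    (hd : ∀ k, ∀ z ∈ chains X (k + 1), bdry k (d (k + 1) z) = d k (bdry k z))
    (k : ℕ) {z : Chains ι (k + 1)} (hz : z ∈ chains X (k + 1)) :
    bdry (k + 1) (contraction X a d (k + 1) z) =
      d (k + 1) z - contraction X a d k (bdry k z) := by
  induction k with
  | zero =>
    refine eqOn_chains (f := bdry 1 ∘ₗ contraction X a d 1)
      (g := d 1 - contraction X a d 0 ∘ₗ bdry 0) (fun t ht => ?_) hz
    have cycle : bdry 0 (d 1 (Finsupp.single t 1)) = 0 := by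
      rw [hd 0 _ (single_mem_chains X ht 1), hd₀, LinearMap.zero_apply]
    rw [LinearMap.comp_apply, contraction_single ht, bdry_cone_succ]
    simp [contraction, cycle]
  | succ k ih =>
    refine eqOn_chains (f := bdry (k + 2) ∘ₗ contraction X a d (k + 2))
      (g := d (k + 2) - contraction X a d (k + 1) ∘ₗ bdry (k + 1)) (fun t ht => ?_) hz
    have ht' := single_mem_chains X ht 1
    have cycle : bdry (k + 1) (d (k + 2) (Finsupp.single t 1) -
        contraction X a d (k + 1) (bdry (k + 1) (Finsupp.single t 1))) = 0 := by
      rw [map_sub, hd _ _ ht', ih (bdry_mem_chains X ht'), bdry_bdry, map_zero, sub_zero, sub_self]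
    simp only [LinearMap.comp_apply, LinearMap.sub_apply, contraction_single ht, bdry_cone_succ,
      cycle, map_zero, sub_zero]

variable {C : FacePoset X → Set κ}

theorem contraction_single_mem_chainsOn (hC : Monotone C) (ha : ∀ s, IsConeApex Y (C s) (a s))
    (hdC : ∀ k (t : Fin (k + 1) → ι) (ht : Spans X t),
      d (k + 1) (Finsupp.single t 1) ∈ chainsOn Y (C (spanSimplex X t ht)) (k + 1))
    (k : ℕ) (t : Fin (k + 1) → ι) (ht : Spans X t) :
    contraction X a d (k + 1) (Finsupp.single t 1) ∈
      chainsOn Y (C (spanSimplex X t ht)) (k + 2) := by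
  rw [contraction_single ht]
  refine (ha _).cone_mem_chainsOn
    (Submodule.sub_mem _ (hdC k t ht) (map_bdry_single_mem fun i => ?_))
  induction k with
  | zero => exact Submodule.zero_mem _
  | succ k ih =>
    refine chainsOn_mono (hC (spanSimplex_omit_le ht i)) _ ?_
    rw [contraction_single (spans_omit X ht i)]
    exact (ha _).cone_mem_chainsOn (Submodule.sub_mem _ (hdC k _ _) (map_bdry_single_mem (ih _ _)))

theorem mem_boundaries_of_carrier (hC : Monotone C) (hcone : ∀ s, ∃ a, IsConeApex Y (C s) a)
    (hd₀ : d 0 = 0) (hd : ∀ k, ∀ z ∈ chains X (k + 1), bdry k (d (k + 1) z) = d k (bdry k z))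
    (hdC : ∀ k (t : Fin (k + 1) → ι) (ht : Spans X t),
      d (k + 1) (Finsupp.single t 1) ∈ chainsOn Y (C (spanSimplex X t ht)) (k + 1))
    {k : ℕ} {z : Chains ι k} (hz : z ∈ cycles X k) : d k z ∈ boundaries Y k := by
  choose a ha using hcone
  obtain _ | k := k
  · rw [hd₀]
    exact Submodule.zero_mem _
  · have hmem : chains X (k + 1) ≤ (chains Y (k + 2)).comap (contraction X a d (k + 1)) :=
      (chains_le_iff X).2 fun t ht => (contraction_single_mem_chainsOn hC ha hdC k t ht).1
    refine ⟨contraction X a d (k + 1) z, hmem hz.1, ?_⟩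
    rw [bdry_contraction hd₀ hd k hz.1, LinearMap.mem_ker.1 hz.2, map_zero, sub_zero]

end ConicalCarrier

section Subdivision
variable {ι : Type*} {X : AbstractSimplicialComplex ι}

theorem subdivide_zero_single (t : Fin 0 → ι) (u : Fin 0 → FacePoset X) :
    subdivide X 0 (Finsupp.single t 1) = Finsupp.single u 1 := by
  rw [subdivide, Finsupp.lmapDomain_apply, Finsupp.mapDomain_single]
  exact congrArg (Finsupp.single · 1) (Subsingleton.elim _ u)

theorem exists_isGreatest_of_mem_orderComplex {P : Type*} [PartialOrder P] {s : Finset P}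
    (hs : s ∈ (orderComplex P).faces) : ∃ m, IsGreatest (s : Set P) m := by
  obtain ⟨m, hm⟩ := s.exists_maximal hs.1
  exact ⟨m, hm.prop, fun p hp => (hs.2.total hp hm.prop).elim id (hm.le_of_ge hp)⟩

theorem exists_simplicialMap_mem (X : AbstractSimplicialComplex ι) :
    ∃ φ : SimplicialMap (orderComplex (FacePoset X)) X, ∀ s, φ.toFun s ∈ s.1 := by
  classical
  choose v hv using fun s : FacePoset X => (X.isRelLowerSet_faces s.2).1
  refine ⟨⟨v, fun s hs => ?_⟩, hv⟩
  obtain ⟨m, hm⟩ := exists_isGreatest_of_mem_orderComplex hs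
  have hsub : s.image v ⊆ m.1 := Finset.image_subset_iff.2 fun u hu => hm.2 hu (hv u)
  exact ⟨s.image v, (X.isRelLowerSet_faces m.2).2 hsub (hs.1.image v), Finset.coe_image⟩

theorem isConeApex_face {s : Finset ι} (hs : s ∈ X.faces) {a : ι} (ha : a ∈ s) :
    IsConeApex X (s : Set ι) a :=
  ⟨ha, fun _ _ hus => ⟨s, hs, ha, Finset.coe_subset.1 hus⟩⟩

theorem isConeApex_lowerClosure {P : Type*} [PartialOrder P] {S : Set P} {m : P}
    (hm : IsGreatest S m) : IsConeApex (orderComplex P) (lowerClosure S) m := by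
  classical
  refine ⟨subset_lowerClosure hm.1, fun s hs hsS => ⟨insert m s, ⟨s.insert_nonempty m, ?_⟩,
    s.mem_insert_self m, s.subset_insert m⟩⟩
  rw [Finset.coe_insert]
  refine hs.2.insert fun p hp _ => Or.inr ?_
  obtain ⟨q, hq, hpq⟩ := hsS hp
  exact hpq.trans (hm.2 hq)

variable {φ : SimplicialMap (orderComplex (FacePoset X)) X}

theorem redMap_subdivision (hφ : ∀ s, φ.toFun s ∈ s.1) (k : ℕ) (x : RedHomology X k) :
    redMap φ k (subdivision X k x) = x := by
  obtain ⟨⟨z, hz⟩, rfl⟩ := Submodule.Quotient.mk_surjective _ x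
  refine (Submodule.Quotient.eq _).2 ?_
  refine mem_boundaries_of_carrier (X := X) (Y := X) (C := fun s => s.1)
    (d := fun k => push φ.toFun k ∘ₗ subdivide X k - LinearMap.id)
    (fun _ _ h => Finset.coe_subset.2 h) ?_ ?_ ?_ ?_ hz
  · intro s
    obtain ⟨a, ha⟩ := (X.isRelLowerSet_faces s.2).1
    exact ⟨a, isConeApex_face s.2 ha⟩
  · refine chains_hom_ext fun t => ?_
    simp [subdivide_zero_single t Fin.elim0, push_single, Subsingleton.elim _ t]
  · intro k c hc
    simp [bdry_push, bdry_subdivide X k hc]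
  · intro k t ht
    refine Submodule.sub_mem _ ?_ (single_mem_chainsOn ht (apply_mem_spanSimplex ht))
    refine ⟨push_mem_chains φ (subdivide_mem_chains X (single_mem_chains X ht 1)),
      Finsupp.supported_comap_lmapDomain ℤ ℤ _ _
        (Finsupp.supported_mono ?_ (subdivide_mem_supported X (k + 1) t ht))⟩
    rintro u ⟨-, hu⟩ i
    rw [coe_spanSimplex]
    exact hu i (hφ (u i))

theorem subdivision_redMap_self (hφ : ∀ s, φ.toFun s ∈ s.1) (k : ℕ)
    (x : RedHomology (orderComplex (FacePoset X)) k) :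
    subdivision X k (redMap φ k x) = x := by
  obtain ⟨⟨z, hz⟩, rfl⟩ := Submodule.Quotient.mk_surjective _ x
  refine (Submodule.Quotient.eq _).2 ?_
  refine mem_boundaries_of_carrier (X := orderComplex (FacePoset X))
    (Y := orderComplex (FacePoset X)) (C := fun s => lowerClosure (s.1 : Set (FacePoset X)))
    (d := fun k => subdivide X k ∘ₗ push φ.toFun k - LinearMap.id)
    (fun _ _ h => lowerClosure_mono (Finset.coe_subset.2 h)) ?_ ?_ ?_ ?_ hz
  · intro s
    obtain ⟨m, hm⟩ := exists_isGreatest_of_mem_orderComplex s.2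
    exact ⟨m, isConeApex_lowerClosure hm⟩
  · refine chains_hom_ext fun t => ?_
    simp [push_single, subdivide_zero_single _ t]
  · intro k c hc
    simp [← bdry_push, bdry_subdivide X k (push_mem_chains φ hc)]
  · intro k t ht
    refine Submodule.sub_mem _ ?_
      (single_mem_chainsOn ht fun i => subset_lowerClosure (apply_mem_spanSimplex ht i))
    obtain ⟨m, hm⟩ := exists_isGreatest_of_mem_orderComplex (spanSimplex _ t ht).2
    have hφt : Spans X (φ.toFun ∘ t) :=
      Or.inr ⟨m.1, m.2, fun i => hm.2 (apply_mem_spanSimplex ht i) (hφ (t i))⟩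
    refine ⟨subdivide_mem_chains X (push_mem_chains φ (single_mem_chains _ ht 1)), ?_⟩
    rw [LinearMap.comp_apply, push_single]
    refine Finsupp.supported_mono ?_ (subdivide_mem_supported X (k + 1) _ hφt)
    rintro u ⟨-, hu⟩ i
    refine ⟨m, hm.1, (hu i).trans ?_⟩
    rintro _ ⟨j, rfl⟩
    exact hm.2 (apply_mem_spanSimplex ht j) (hφ (t j))

theorem subdivision_bijective (X : AbstractSimplicialComplex ι) (k : ℕ) :
    Function.Bijective (subdivision X k) := by
  obtain ⟨φ, hφ⟩ := exists_simplicialMap_mem X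
  exact Function.bijective_iff_has_inverse.2
    ⟨redMap φ k, redMap_subdivision hφ k, subdivision_redMap_self hφ k⟩

end Subdivision

section Naturality
variable {ι κ μ : Type*} {X A : AbstractSimplicialComplex ι} {Y B : AbstractSimplicialComplex κ}
  {Z : AbstractSimplicialComplex μ}

/-- The composite of two simplicial maps. -/
def SimplicialMap.comp (g : SimplicialMap Y Z) (f : SimplicialMap X Y) : SimplicialMap X Z where
  toFun := g.toFun ∘ f.toFun
  image_mem s hs := by
    obtain ⟨t, ht, hts⟩ := f.image_mem s hs
    obtain ⟨u, hu, hut⟩ := g.image_mem t ht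
    exact ⟨u, hu, by rw [hut, hts, Set.image_comp]⟩

theorem redMap_comp (g : SimplicialMap Y Z) (f : SimplicialMap X Y) (k : ℕ) (x : RedHomology X k) :
    redMap (g.comp f) k x = redMap g k (redMap f k x) := by
  obtain ⟨⟨c, hc⟩, rfl⟩ := Submodule.Quotient.mk_surjective _ x
  refine congrArg Submodule.Quotient.mk (Subtype.ext ?_)
  exact LinearMap.congr_fun (Finsupp.lmapDomain_comp ℤ ℤ (f.toFun ∘ ·) (g.toFun ∘ ·)) c

theorem connecting_relMap (f : SimplicialMap X Y) (g : SimplicialMap A B)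
    (hfg : g.toFun = f.toFun) (n : ℕ) (x : RelHomology X A n) :
    connecting Y B n (relMap f g hfg n x) = redMap g n (connecting X A n x) := by
  obtain ⟨⟨c, hc⟩, rfl⟩ := Submodule.Quotient.mk_surjective _ x
  refine congrArg Submodule.Quotient.mk (Subtype.ext ?_)
  change bdry n (push f.toFun (n + 1) c) = push g.toFun n (bdry n c)
  rw [bdry_push, hfg]

open Classical in
/-- The poset map `P(X) → P(Y)` induced by a simplicial map `X → Y`. -/
noncomputable def faceMap (f : SimplicialMap X Y) : FacePoset X →o FacePoset Y where
  toFun s := ⟨s.1.image f.toFun, by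
    obtain ⟨t, ht, hts⟩ := f.image_mem s.1 s.2
    rw [← Finset.coe_image, Finset.coe_inj] at hts
    exact hts ▸ ht⟩
  monotone' := fun _ _ h => Finset.image_subset_image h

theorem push_cone (f : ι → κ) (a : ι) (k : ℕ) (c : Chains ι k) :
    push f (k + 1) (cone a k c) = cone (f a) k (push f k c) := by
  have h : push f (k + 1) ∘ₗ cone a k = cone (f a) k ∘ₗ push f k :=
    chains_hom_ext fun t => by
      simp only [LinearMap.comp_apply, cone_single, push_single, Fin.comp_cons]
  exact LinearMap.congr_fun h c

theorem spans_comp (f : SimplicialMap X Y) {k : ℕ} {t : Fin k → ι} (ht : Spans X t) :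
    Spans Y (f.toFun ∘ t) := by
  refine ht.imp id fun ⟨s, hs, hst⟩ => ?_
  obtain ⟨u, hu, hus⟩ := f.image_mem s hs
  exact ⟨u, hu, fun i => Finset.mem_coe.1 (hus ▸ Set.mem_image_of_mem f.toFun (hst i))⟩

open Classical in
theorem spanSimplex_comp (f : SimplicialMap X Y) {k : ℕ} {t : Fin (k + 1) → ι} (ht : Spans X t) :
    spanSimplex Y (f.toFun ∘ t) (spans_comp f ht) = faceMap f (spanSimplex X t ht) :=
  Subtype.ext Finset.image_image.symm

theorem subdivide_push (f : SimplicialMap X Y) (k : ℕ) {c : Chains ι k} (hc : c ∈ chains X k) :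
    subdivide Y k (push f.toFun k c) = push (faceMap f) k (subdivide X k c) := by
  induction k with
  | zero =>
    refine LinearMap.congr_fun (chains_hom_ext (f := subdivide Y 0 ∘ₗ push f.toFun 0)
      (g := push (faceMap f) 0 ∘ₗ subdivide X 0) fun t => ?_) c
    rw [LinearMap.comp_apply, LinearMap.comp_apply, push_single, subdivide_zero_single t Fin.elim0,
      push_single, subdivide_zero_single]
  | succ k ih =>
    refine eqOn_chains (f := subdivide Y (k + 1) ∘ₗ push f.toFun (k + 1))
      (g := push (faceMap f) (k + 1) ∘ₗ subdivide X (k + 1)) (fun t ht => ?_) hc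
    rw [LinearMap.comp_apply, LinearMap.comp_apply, subdivide_single X ht, push_cone,
      ← ih (bdry_mem_chains X (single_mem_chains X ht 1)), ← bdry_push, push_single,
      subdivide_single Y (spans_comp f ht), spanSimplex_comp]

theorem subdivision_redMap (f : SimplicialMap X Y) (k : ℕ) (x : RedHomology X k) :
    subdivision Y k (redMap f k x) =
      redMap (orderComplexMap (faceMap f)) k (subdivision X k x) := by
  obtain ⟨⟨c, hc⟩, rfl⟩ := Submodule.Quotient.mk_surjective _ x
  exact congrArg Submodule.Quotient.mk
    (Subtype.ext (subdivide_push f k (cycles_le_chains X k hc)))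

end Naturality

section Apartment
variable {n : ℕ}

theorem span_toRat_image_span (S : Set (SymIdx n → ℤ)) :
    Submodule.span ℚ (toRat '' (Submodule.span ℤ S : Set (SymIdx n → ℤ))) =
      Submodule.span ℚ (toRat '' S) := by
  let L : (SymIdx n → ℤ) →ₗ[ℤ] SymIdx n → ℚ := (Int.castAddHom ℚ).toIntLinearMap.compLeft (SymIdx n)
  change Submodule.span ℚ (L '' Submodule.span ℤ S) = Submodule.span ℚ (L '' S)
  rw [← Submodule.map_coe, Submodule.map_span, Submodule.span_span_of_tower]

theorem lineSpan_image_columnLine (M : Sp n) (I : Finset (SymIdx n)) :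
    lineSpan (I.image (columnLine M)) = Submodule.span ℤ (column M '' I) := by
  rw [lineSpan, Finset.iSup_finset_image, Set.image_eq_iUnion, Submodule.span_iUnion₂]
  rfl

theorem spanPosetMap_comp_faceMap (M : Sp n) :
    (spanPosetMap n).comp (faceMap (sphereMap M)) = apartmentMap M := by
  classical
  refine OrderHom.ext _ _ (funext fun I => Subtype.ext ?_)
  calc ratSpan (I.1.image (columnLine M))
      = Submodule.span ℚ (toRat '' (column M '' I.1)) := by
        rw [ratSpan, lineSpan_image_columnLine, span_toRat_image_span]
    _ = Submodule.span ℚ ((fun a => toRat (column M a)) '' I.1) := by rw [Set.image_image]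

theorem spanMap_redMap_faceMap (M : Sp n)
    (x : RedHomology (orderComplex (FacePoset (bdryBeta n))) n) :
    spanMap n (redMap (orderComplexMap (faceMap (sphereMap M))) n x) =
      redMap (orderComplexMap (apartmentMap M)) n x := by
  rw [← spanPosetMap_comp_faceMap, spanMap, ← redMap_comp]
  rfl

theorem extendLinearly_single {A : Type*} [AddCommGroup A] (f : Sp n → A) (M : Sp n) :
    extendLinearly f (MonoidAlgebra.single M 1) = f M := by
  simp [extendLinearly]

theorem connecting_alpha_single (hn : 1 ≤ n) (ξ₀ : RedHomology (bdryBeta 1) 1) (M : Sp n) :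
    connecting (IA n) (IDelta n) n (alpha n hn ξ₀ (MonoidAlgebra.single M 1)) =
      redMap (sphereMap M) n (fundamentalClass ξ₀ n) := by
  rw [alpha, extendLinearly_single]
  exact (connecting_relMap (discMap M) (sphereMap M) rfl n _).trans
    (congrArg _ ((connectingBeta n hn).apply_symm_apply _))

end Apartment

end SymplecticApartments

theorem proposition5p1 (n : ℕ) (hn : 1 ≤ n) (ξ₀ : RedHomology (bdryBeta 1) 1)
    (hξ₀ : Submodule.span ℤ {ξ₀} = ⊤) :
    Function.Bijective (subdivision (IDelta n) n) ∧
      apartmentClassMap n ξ₀ =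
        spanMap n ∘ₗ subdivision (IDelta n) n ∘ₗ connecting (IA n) (IDelta n) n ∘ₗ
          alpha n hn ξ₀ := by
  refine ⟨subdivision_bijective (IDelta n) n,
    MonoidAlgebra.lhom_ext' fun M => LinearMap.ext_ring ?_⟩
  let ξ := fundamentalClass ξ₀ n
  calc apartmentClassMap n ξ₀ (MonoidAlgebra.single M 1)
      = redMap (orderComplexMap (apartmentMap M)) n (subdivision (bdryBeta n) n ξ) :=
        extendLinearly_single _ M
    _ = spanMap n (redMap (orderComplexMap (faceMap (sphereMap M))) n
          (subdivision (bdryBeta n) n ξ)) := (spanMap_redMap_faceMap M _).symm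
    _ = spanMap n (subdivision (IDelta n) n (redMap (sphereMap M) n ξ)) := by
        rw [subdivision_redMap]
    _ = spanMap n (subdivision (IDelta n) n (connecting (IA n) (IDelta n) n
          (alpha n hn ξ₀ (MonoidAlgebra.single M 1)))) := by
        rw [connecting_alpha_single]
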